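/- **Definitions.** A *blueprint* $\Gamma=(M,S,\mathfrak i,\mathfrak t,R)$ consists of nonempty sets $M$ (states) and $S$ (generators), maps $\mathfrak i\colon S\to M$ and $\mathfrak t\colon S\to\mathcal P(M)\setminus\{\varnothing\}$, and a set $R\subseteq S^*\times S^*$ of relations. It is *finitely presented* if $M,S,R$ are finite. A word $w_1\cdots w_n\in S^*$ is *$\Gamma$-consistent* if $\mathfrak i(w_{k+1})\in\mathfrak t(w_k)$ for $1\le k<n$. Two $\Gamma$-consistent words are *$\Gamma$-similar* if they have the form $xwy$ and $xw'y$ with $(w,w')\in R$ and $x,y\in S^*$; *$\Gamma$-equivalence* is the equivalence relation generated by $\Gamma$-similarity, and $\underline w$ is the class of $w$. A map $\varphi\colon S^*\to M\cup\{\varnothing\}$, with support $\mathrm{supp}(\varphi)=\{w:\varphi(w)\ne\varnothing\}$, is *$\Gamma$-consistent* if $\varphi(\varepsilon)\in M$ and, for all $w\in S^*$, $s\in S$: $\varphi(ws)\in\mathfrak t(s)$ if $\varphi(w)=\mathfrak i(s)$, and $\varphi(ws)=\varnothing$ otherwise. It is a *model* if moreover $\varphi(u)=\varphi(v)$ for all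 $\Gamma$-equivalent $u,v\in\mathrm{supp}(\varphi)$; $\mathcal M(\Gamma)$ is the set of models. Call $\Gamma$ *coherent* if for every $\Gamma$-consistent $\varphi$ that takes equal values at $\Gamma$-similar words of its support, any two $\Gamma$-equivalent words of $\mathrm{supp}(\varphi)$ can be joined by a finite sequence of words of $\mathrm{supp}(\varphi)$ in which consecutive words are $\Gamma$-similar. The *model graph* $G(\Gamma,\varphi)$ has vertices $\underline w$ ($w\in\mathrm{supp}(\varphi)$) and edges $(\underline w,\underline{ws},s)$ for $w\in\mathrm{supp}(\varphi)$, $s\in S$, $\mathfrak i(s)=\varphi(w)$. $\Gamma$ is *strongly connected* if in each of its model graphs there is a directed path from every vertex to every vertex; a model graph then carries the quasi-metric $\rho(a,b)=$ length of a shortest directed path from $a$ to $b$. A map $f\colon X\to Y$ of quasi-metric spaces is a *quasi-isometry* if there are $C,D\ge 0$, $\lambda\ge 1$ with $\frac1\lambda\rho_X(x,y)-C\le\rho_Y(f(x),f(y))\le\lambda\rho_X(x,y)+C$ for all $x,y\in X$, and such that for every $z\in Y$ there is $x\in X$ with $\max\{\rho_Y(z,f(x)),\rho_Y(f(x),z)\}\le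 D$; $X$ is quasi-isometric to $Y$ if such an $f$ exists. $\Gamma$ is *minimal* if for every model $\varphi$ the closure, in the prodiscrete topology of $(M\cup\{\varnothing\})^{S^*}$, of $\{u\mapsto\varphi(wu): w\in\mathrm{supp}(\varphi)\}$ is $\mathcal M(\Gamma)$. Let $A$ be a finite alphabet. A *nearest neighbor pattern* is a map $p\colon S^*\to(M\times A)\cup\{\varnothing\}$ with support $\{\varepsilon,s\}$ for some $s\in S$. For a finite set $\mathcal F$ of such patterns and a model $\varphi$, let $X[\Gamma,\varphi,\mathcal F]$ be the set of all $x\colon S^*\to A\cup\{\varnothing\}$ such that $\mathrm{supp}(x)=\mathrm{supp}(\varphi)$, $x(u)=x(v)$ for all $\Gamma$-equivalent $u,v\in\mathrm{supp}(\varphi)$, and for all $p\in\mathcal F$ and $w\in\mathrm{supp}(\varphi)$ there is $u\in\mathrm{supp}(p)$ with $(\varphi(wu),x(wu))\ne p(u)$. The *$\varphi$-domino problem* asks, given $A$ and $\mathcal F$, whether $X[\Gamma,\varphi,\mathcal F]\neq\varnothing$; the *$\Gamma$-domino problem* asks, given $A$ and $\mathcal F$, whether $X[\Gamma,\varphi,\mathcal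 F]\ne\varnothing$ for some $\varphi\in\mathcal M(\Gamma)$. (The empty alphabet is allowed.) **Theorem.** Let $\Gamma_1,\Gamma_2$ be finitely presented, coherent, strongly connected blueprints, with $\Gamma_1$ minimal, and let $\varphi_2\in\mathcal M(\Gamma_2)$. Suppose that there is $\varphi_1\in\mathcal M(\Gamma_1)$ such that $G(\Gamma_1,\varphi_1)$ is quasi-isometric to $G(\Gamma_2,\varphi_2)$. Then the $\Gamma_1$-domino problem many-one reduces to the $\varphi_2$-domino problem: there is a total computable map taking each instance of the former to an instance of the latter with the same answer. -/

import Mathlib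

/-- A blueprint with set of states `M` and set of generators `S`: initial states, nonempty sets of
possible final states, and a set of relations between words over `S`. -/
structure Blueprint (M S : Type*) where
  states_nonempty : Nonempty M
  generators_nonempty : Nonempty S
  init : S → M
  term : S → Set M
  term_nonempty : ∀ s, (term s).Nonempty
  rels : Set (List S × List S)

/-- The support of a map into `X ∪ {∅}`, where `∅` is `none`. -/
def optionSupport {W X : Type*} (f : W → Option X) : Set W := {w | f w ≠ none}

/-- A pattern: a finitely supported map `S* → (M × A) ∪ {∅}`. -/
structure BlueprintPattern (M S A : Type*) where
  toFun : List S → Option (M × A)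
  finite_support : (optionSupport toFun).Finite

/-- `f` is a quasi-isometry between two sets with (not necessarily symmetric) distances. -/
def IsQuasiIsometry {X Y : Type*} (ρX : X → X → ℝ) (ρY : Y → Y → ℝ) (f : X → Y) : Prop :=
  ∃ C D lam : ℝ, 0 ≤ C ∧ 0 ≤ D ∧ 1 ≤ lam ∧
    (∀ x y, 1 / lam * ρX x y - C ≤ ρY (f x) (f y) ∧ ρY (f x) (f y) ≤ lam * ρX x y + C) ∧
    (∀ z, ∃ x, max (ρY z (f x)) (ρY (f x) z) ≤ D)

/-- `E` has a directed path of length `n` from `x` to `y`. -/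
def HasDirectedPath {V : Type*} (E : V → V → Prop) (n : ℕ) (x y : V) : Prop :=
  ∃ v : ℕ → V, v 0 = x ∧ v n = y ∧ ∀ k < n, E (v k) (v (k + 1))

/-- The length of a shortest directed path (only used for strongly connected graphs, where the set
of lengths is never empty). -/
noncomputable def directedDist {V : Type*} (E : V → V → Prop) (x y : V) : ℝ :=
  ((sInf {n : ℕ | HasDirectedPath E n x y} : ℕ) : ℝ)

namespace Blueprint

variable {M S : Type*} (Γ : Blueprint M S)

/-- Finite sets of states, generators and relations. -/
def FinitelyPresented : Prop := Finite M ∧ Finite S ∧ Γ.rels.Finite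

/-- `Γ`-consistent words. -/
def ConsistentWord (w : List S) : Prop := w.IsChain (fun a b => Γ.init b ∈ Γ.term a)

/-- `Γ`-similarity of consistent words. -/
def Similar (u v : List S) : Prop :=
  Γ.ConsistentWord u ∧ Γ.ConsistentWord v ∧
    ∃ r ∈ Γ.rels, ∃ x y : List S, u = x ++ r.1 ++ y ∧ v = x ++ r.2 ++ y

/-- `Γ`-equivalence: the equivalence relation generated by `Γ`-similarity. -/
def equivalence : Setoid (List S) := Relation.EqvGen.setoid Γ.Similar

/-- Two words are `Γ`-equivalent. -/
def Equivalent (u v : List S) : Prop := Relation.EqvGen Γ.Similar u v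

/-- `Γ`-consistent maps `S* → M ∪ {∅}`. -/
def ConsistentMap (φ : List S → Option M) : Prop :=
  φ [] ≠ none ∧ ∀ (w : List S) (s : S),
    (φ w = some (Γ.init s) → ∃ m ∈ Γ.term s, φ (w ++ [s]) = some m) ∧
    (φ w ≠ some (Γ.init s) → φ (w ++ [s]) = none)

/-- The space `𝓜(Γ)` of `Γ`-models. -/
def modelSpace : Set (List S → Option M) :=
  {φ | Γ.ConsistentMap φ ∧
    ∀ u ∈ optionSupport φ, ∀ v ∈ optionSupport φ, Γ.Equivalent u v → φ u = φ v}

/-- The relations can be tested inside supports: whenever a `Γ`-consistent map takes equal values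
at `Γ`-similar words of its support, any two `Γ`-equivalent words of its support are joined by a
finite sequence of words of its support, in which consecutive words are `Γ`-similar. -/
def Coherent : Prop :=
  ∀ φ : List S → Option M, Γ.ConsistentMap φ →
    (∀ u ∈ optionSupport φ, ∀ v ∈ optionSupport φ, Γ.Similar u v → φ u = φ v) →
    ∀ u ∈ optionSupport φ, ∀ v ∈ optionSupport φ, Γ.Equivalent u v →
      Relation.EqvGen
        (fun a b => a ∈ optionSupport φ ∧ b ∈ optionSupport φ ∧ Γ.Similar a b) u v

/-- The vertices of the model graph of `φ`: the `Γ`-equivalence classes of words of its support. -/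
def vertices (φ : List S → Option M) : Set (Quotient Γ.equivalence) :=
  {c | ∃ w ∈ optionSupport φ, c = Quotient.mk Γ.equivalence w}

/-- The model graph of `φ` has an edge labelled `s` from `a` to `b`. -/
def LabelledEdge (φ : List S → Option M) (a b : Γ.vertices φ) (s : S) : Prop :=
  ∃ w ∈ optionSupport φ, φ w = some (Γ.init s) ∧
    a.1 = Quotient.mk Γ.equivalence w ∧ b.1 = Quotient.mk Γ.equivalence (w ++ [s])

/-- The model graph of `φ` has an edge from `a` to `b`. -/
def Edge (φ : List S → Option M) (a b : Γ.vertices φ) : Prop := ∃ s, Γ.LabelledEdge φ a b s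

/-- Every model graph has a directed path between any two vertices. -/
def StronglyConnected : Prop :=
  ∀ φ ∈ Γ.modelSpace, ∀ a b : Γ.vertices φ, ∃ n, HasDirectedPath (Γ.Edge φ) n a b

/-- The quasi-metric of the model graph of `φ`. -/
noncomputable def modelDist (φ : List S → Option M) : Γ.vertices φ → Γ.vertices φ → ℝ :=
  directedDist (Γ.Edge φ)

/-- The orbit of `φ` under the partial right action of `S*`. -/
def orbit (φ : List S → Option M) : Set (List S → Option M) :=
  {ψ | ∃ w ∈ optionSupport φ, ψ = fun u => φ (w ++ u)}

/-- `φ` has a dense orbit in `𝓜(Γ)`, for the prodiscrete topology. -/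
def DenseModel (φ : List S → Option M) : Prop :=
  @closure (List S → Option M)
    (@Pi.topologicalSpace (List S) (fun _ => Option M) (fun _ => ⊥)) (orbit φ) = Γ.modelSpace

/-- Every model is dense. -/
def Minimal : Prop := ∀ φ ∈ Γ.modelSpace, Γ.DenseModel φ

/-- The `φ`-subshift over the alphabet `A` given by a set `F` of forbidden patterns. -/
def modelSubshift {A : Type*} (φ : List S → Option M) (F : Set (BlueprintPattern M S A)) :
    Set (List S → Option A) :=
  {x | optionSupport x = optionSupport φ ∧
    (∀ u ∈ optionSupport φ, ∀ v ∈ optionSupport φ, Γ.Equivalent u v → x u = x v) ∧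
    (∀ p ∈ F, ∀ w ∈ optionSupport φ, ∃ u ∈ optionSupport p.toFun,
      Option.map₂ Prod.mk (φ (w ++ u)) (x (w ++ u)) ≠ p.toFun u)}

/-- The `Γ`-subshift over the alphabet `A` given by a set `F` of forbidden patterns. -/
def subshift {A : Type*} (F : Set (BlueprintPattern M S A)) :
    Set ((List S → Option M) × (List S → Option A)) :=
  {q | q.1 ∈ Γ.modelSpace ∧ q.2 ∈ Γ.modelSubshift q.1 F}

end Blueprint

open Classical in
/-- The nearest neighbor pattern with support `{ε, s}` and values `p` at `ε` and `q` at `s`. -/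
noncomputable def nearestNeighborPattern {M S A : Type*} (s : S) (p q : M × A) :
    BlueprintPattern M S A where
  toFun w := if w = [] then some p else if w = [s] then some q else none
  finite_support := by
    refine Set.Finite.subset (Set.toFinite {[], [s]}) ?_
    intro w hw
    by_contra h
    simp only [Set.mem_insert_iff, Set.mem_singleton_iff, not_or] at h
    exact hw (by simp [h.1, h.2])

/-- Descriptions of an alphabet and a finite set of nearest neighbor patterns: `(n, L)` describes
the alphabet `{0, …, n - 1}` and the patterns with support `{ε, s}` and values `(m, a)` at `ε` and
`(m', b)` at `s`, one for each entry `(s, (m, a), (m', b))` of the list `L` with `a, b < n`. -/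
abbrev DominoInstance (M S : Type*) := ℕ × List (S × (M × ℕ) × (M × ℕ))

/-- The set of nearest neighbor patterns that is described by an instance. -/
def DominoInstance.patterns {M S : Type*} (I : DominoInstance M S) :
    Set (BlueprintPattern M S (Fin I.1)) :=
  {p | ∃ (s : S) (m m' : M) (a b : Fin I.1),
    (s, (m, (a : ℕ)), (m', (b : ℕ))) ∈ I.2 ∧ p = nearestNeighborPattern s (m, a) (m', b)}

/-- The `Γ`-domino problem, as the set of its positive instances. -/
def Blueprint.DominoProblem {M S : Type*} (Γ : Blueprint M S) (I : DominoInstance M S) : Prop :=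
  (Γ.subshift (DominoInstance.patterns I)).Nonempty

/-- The `φ`-domino problem, as the set of its positive instances. -/
def Blueprint.ModelDominoProblem {M S : Type*} (Γ : Blueprint M S) (φ : List S → Option M)
    (I : DominoInstance M S) : Prop :=
  (Γ.modelSubshift φ (DominoInstance.patterns I)).Nonempty

/-! A configuration on `φ₂` can be made to draw a whole coloured model of `Γ₁`. Every vertex of the
graph of `φ₂` carries boundedly many items. An item stands for a vertex of a `Γ₁`-model: it has a
state, a colour, and for each generator of `Γ₁` a pointer, that is, a bounded displacement together
with the index of another item. The local rules ask that an item is visible from everywhere, that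
pointers lead to items with legal states, that the two sides of each relation of `Γ₁` lead from an
item to the same item, and that no pattern of the given instance occurs along a pointer.

Soundness (`Cell.dominoProblem_of_realizes`): start at any item and read the states along pointers.
Coherence of `Γ₁` says that closing up the relations locally is enough, so this is a model of `Γ₁`,
and the colours form a valid configuration on it. It need not be `φ₁`; the `Γ₁`-problem accepts any
model.

Completeness: suppose some model of `Γ₁` has a configuration. By minimality its orbit accumulates at
`φ₁`, and compactness gives a configuration on `φ₁` (`modelSubshift_nonempty_of_denseModel`). The
quasi-isometry moves adjacent vertices a bounded distance apart, has fibres of bounded size and is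
coarsely onto, so `φ₁` can be drawn on `φ₂` with bounded pointers and finitely many indices
(`exists_vertexCoding`, `VertexCoding.realizes_cells`).

Computability: the rules about states and pointers look at windows of a fixed size `L` and do not
depend on the instance. They are a fixed finite table, however hard it may be to find, and only the
colour constraints vary. Letters that store a whole window and must agree with their neighbors on
overlaps turn these rules into nearest neighbor patterns (`WindowRules.exists_computable`). -/

theorem mem_modelSubshift_patterns {M S : Type*} (Γ : Blueprint M S) (φ : List S → Option M)
    (I : DominoInstance M S) (x : List S → Option (Fin I.1)) :
    x ∈ Γ.modelSubshift φ (DominoInstance.patterns I) ↔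
      optionSupport x = optionSupport φ ∧
      (∀ u ∈ optionSupport φ, ∀ v ∈ optionSupport φ, Γ.Equivalent u v → x u = x v) ∧
      ∀ (w : List S) (s : S) (m m' : M) (a b : Fin I.1), φ w = some m →
        φ (w ++ [s]) = some m' → x w = some a → x (w ++ [s]) = some b →
        (s, (m, (a : ℕ)), (m', (b : ℕ))) ∉ I.2 := by
  refine and_congr_right fun _ => and_congr_right fun _ => ⟨?_, ?_⟩
  · intro h w s m m' a b h1 h2 h3 h4 hmem
    obtain ⟨u, hu, hne⟩ := h _ ⟨s, m, m', a, b, hmem, rfl⟩ w (by simp [optionSupport, h1])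
    by_cases hu0 : u = []
    · subst hu0
      simp [nearestNeighborPattern, h1, h3] at hne
    · by_cases hu1 : u = [s]
      · subst hu1
        simp [nearestNeighborPattern, h2, h4] at hne
      · simp [nearestNeighborPattern, optionSupport, hu0, hu1] at hu
  · rintro h p ⟨s, m, m', a, b, hmem, rfl⟩ w hw
    by_contra! hcon
    have h0 := hcon [] (by simp [nearestNeighborPattern, optionSupport])
    have h1 := hcon [s] (by simp [nearestNeighborPattern, optionSupport])
    simp only [nearestNeighborPattern, List.append_nil, if_true, List.cons_ne_nil, if_false,
      Option.map₂_eq_some_iff] at h0 h1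
    obtain ⟨_, _, h01, h02, h03⟩ := h0
    obtain ⟨_, _, h11, h12, h13⟩ := h1
    simp only [Prod.mk.injEq] at h03 h13
    obtain ⟨rfl, rfl⟩ := h03
    obtain ⟨rfl, rfl⟩ := h13
    exact h w s _ _ _ _ h01 h11 h02 h12 hmem

/-! ### Colourings coded as numbers in base `n`. -/

theorem Primrec.nat_pow : Primrec₂ ((· ^ ·) : ℕ → ℕ → ℕ) :=
  (Primrec.nat_rec (f := fun _ : ℕ => 1) (g := fun a (p : ℕ × ℕ) => p.2 * a) (.const 1)
    (Primrec.nat_mul.comp (Primrec.snd.comp .snd) .fst).to₂).of_eq fun a n => by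
      induction n with
      | zero => rfl
      | succ n ih => simp only [pow_succ, ← ih]

/-- The digit of `e` at position `i` in base `n`. -/
def baseDigit (n e i : ℕ) : ℕ := e / n ^ i % n

theorem exists_baseDigit_eq {t n : ℕ} (c : Fin t → ℕ) (h : ∀ i, c i < n) :
    ∃ e < n ^ t, ∀ i : Fin t, baseDigit n e i = c i := by
  let c' : Fin t → Fin n := fun i => ⟨c i, h i⟩
  refine ⟨finFunctionFinEquiv c', (finFunctionFinEquiv c').2, fun i => ?_⟩
  have := congrFun (finFunctionFinEquiv.symm_apply_apply c') i
  exact congrArg Fin.val this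

theorem baseDigit_lt {n e t : ℕ} (i : ℕ) (hi : i < t) (h : e < n ^ t) : baseDigit n e i < n := by
  refine Nat.mod_lt _ (Nat.pos_of_ne_zero ?_)
  rintro rfl
  rw [zero_pow (by omega)] at h
  omega

theorem Primrec.baseDigit {α : Type*} [Primcodable α] {f g h : α → ℕ} (hf : Primrec f)
    (hg : Primrec g) (hh : Primrec h) : Primrec fun a => _root_.baseDigit (f a) (g a) (h a) :=
  Primrec.nat_mod.comp (Primrec.nat_div.comp hg (Primrec.nat_pow.comp hf hh)) hf

/-! ### Compiling fixed finite rules into domino instances computably. -/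

/-- Rules for configurations over an alphabet `K × (T → ℕ)`: colours at two slots which are seen by
one letter are constrained by the patterns of a domino instance, the `K`-parts of neighboring
letters are constrained by a fixed relation, and colours of neighboring letters are identified
along a fixed relation. -/
structure SlotRules (M₁ S₁ M₂ S₂ K T : Type*) where
  edge : K → S₁ → M₁ → T → M₁ → T → Prop
  step : K → M₂ → S₂ → K → Prop
  glue : S₂ → T → T → Prop

namespace SlotRules

section
variable {M₁ S₁ M₂ S₂ K T : Type*} (R : SlotRules M₁ S₁ M₂ S₂ K T)

/-- The colours of a letter avoid the patterns of an instance. -/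
def Admissible (F : List (S₁ × (M₁ × ℕ) × (M₁ × ℕ))) (k : K) (c : T → ℕ) : Prop :=
  ∀ r ∈ F, ∀ i j, ¬ (R.edge k r.1 r.2.1.1 i r.2.2.1 j ∧ c i = r.2.1.2 ∧ c j = r.2.2.2)

/-- Two letters may be neighbors along a generator. -/
def Compatible (k : K) (c : T → ℕ) (m : M₂) (s : S₂) (k' : K) (c' : T → ℕ) : Prop :=
  R.step k m s k' ∧ ∀ i j, R.glue s i j → c i = c' j

/-- The configurations which obey the rules. -/
def Realizes (Γ : Blueprint M₂ S₂) (φ : List S₂ → Option M₂) (I : DominoInstance M₁ S₁)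
    (k : List S₂ → Option K) (c : List S₂ → T → ℕ) : Prop :=
  optionSupport k = optionSupport φ ∧
  (∀ u ∈ optionSupport φ, ∀ v ∈ optionSupport φ, Γ.Equivalent u v → k u = k v ∧ c u = c v) ∧
  (∀ w ∈ optionSupport φ, ∀ t, c w t < I.1) ∧
  (∀ w a, k w = some a → R.Admissible I.2 a (c w)) ∧
  ∀ w s m a a', φ w = some m → k w = some a → k (w ++ [s]) = some a' →
    R.Compatible a (c w) m s a' (c (w ++ [s]))

end

section

open scoped Classical

variable {M₁ S₁ M₂ S₂ K T : Type*} (R : SlotRules M₁ S₁ M₂ S₂ K T)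
  [Fintype M₂] [Fintype S₂] [Fintype K] [Fintype T]

/-- The position of a slot. -/
noncomputable def slotIndex (i : T) : ℕ := Fintype.equivFin T i

/-- The colouring with a given code. -/
noncomputable def colouring (n e : ℕ) (i : T) : ℕ := baseDigit n e (slotIndex i)

/-- The nearest neighbor patterns over the alphabet `{0, …, n - 1}`. -/
noncomputable def allPatterns (n : ℕ) : List (S₂ × (M₂ × ℕ) × (M₂ × ℕ)) :=
  (Finset.univ : Finset (S₂ × M₂ × M₂)).toList.flatMap fun x => (List.range n).flatMap fun p =>
    (List.range n).map fun q => (x.1, (x.2.1, p), (x.2.2, q))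

/-- The letters over an instance, where colourings are replaced by their codes. -/
noncomputable def letters (I : DominoInstance M₁ S₁) : List (K × ℕ) :=
  ((Finset.univ : Finset K).toList.flatMap fun k =>
    (List.range (I.1 ^ Fintype.card T)).map fun e => (k, e)).filter
      fun l => R.Admissible I.2 l.1 (colouring I.1 l.2)

/-- The pattern `r` between letters with given numbers is forbidden. -/
def Forbidden (n : ℕ) (l : List (K × ℕ)) (r : S₂ × (M₂ × ℕ) × (M₂ × ℕ)) : Prop :=
  ∃ a ∈ l, ∃ b ∈ l, l[r.2.1.2]? = some a ∧ l[r.2.2.2]? = some b ∧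
    ¬ R.Compatible a.1 (colouring n a.2) r.2.1.1 r.1 b.1 (colouring n b.2)

/-- The instance whose configurations are those which obey the rules. -/
noncomputable def reduction (I : DominoInstance M₁ S₁) : DominoInstance M₂ S₂ :=
  ((R.letters I).length,
    (allPatterns (R.letters I).length).filter fun r => R.Forbidden I.1 (R.letters I) r)

omit [Fintype M₂] [Fintype S₂] in
theorem mem_letters {I : DominoInstance M₁ S₁} {l : K × ℕ} :
    l ∈ R.letters I ↔ l.2 < I.1 ^ Fintype.card T ∧ R.Admissible I.2 l.1 (colouring I.1 l.2) := by
  obtain ⟨k, e⟩ := l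
  simp [letters]

theorem mem_reduction {I : DominoInstance M₁ S₁} {r : S₂ × (M₂ × ℕ) × (M₂ × ℕ)} :
    r ∈ (R.reduction I).2 ↔ R.Forbidden I.1 (R.letters I) r := by
  obtain ⟨s, ⟨m, p⟩, m', q⟩ := r
  simp only [reduction, allPatterns, List.mem_filter, List.mem_flatMap, List.mem_map, List.mem_range,
    Finset.mem_toList, Finset.mem_univ, true_and, decide_eq_true_eq, and_iff_right_iff_imp]
  rintro ⟨a, -, b, -, ha, hb, -⟩
  obtain ⟨hp, -⟩ := List.getElem?_eq_some_iff.1 ha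
  obtain ⟨hq, -⟩ := List.getElem?_eq_some_iff.1 hb
  exact ⟨(s, m, m'), p, hp, q, hq, rfl⟩

variable [Primcodable M₁] [Primcodable S₁] [Primcodable M₂] [Primcodable S₂] [Primcodable K]
  [Primcodable T] [Finite M₁] [Finite S₁]

theorem primrec_colouring {α : Type*} [Primcodable α] {f g : α → ℕ} {h : α → T}
    (hf : Primrec f) (hg : Primrec g) (hh : Primrec h) :
    Primrec fun a => colouring (f a) (g a) (h a) :=
  Primrec.baseDigit hf hg ((Primrec.dom_finite slotIndex).comp hh)

theorem _root_.PrimrecPred.forall_finite {α β : Type*} [Primcodable α] [Primcodable β] [Finite β]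
    {p : α → β → Prop} (h : PrimrecRel p) : PrimrecPred fun a => ∀ b, p a b := by
  have := Fintype.ofFinite β
  refine (PrimrecRel.comp (h.swap.forall_mem_list)
    (Primrec.const (Finset.univ : Finset β).toList) Primrec.id).of_eq fun a => ?_
  simp [Function.swap]

/-- A predicate on a finite type is a finite table, hence primitive recursive whatever its
definition. This is how rules that mention `Γ₂`-equivalence, with no decision procedure at hand,
enter a computable reduction. -/
theorem _root_.PrimrecPred.of_finite {α β : Type*} [Primcodable α] [Primcodable β] [Finite β]
    (p : β → Prop) {f : α → β} (h : Primrec f) : PrimrecPred fun a => p (f a) :=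
  (Primrec.primrecPred (p := p) (Primrec.dom_finite _)).comp h

attribute [local fun_prop] Primrec Primrec.id Primrec.const Primrec.comp Primrec.pair Primrec.fst
  Primrec.snd

theorem primrec_pow_const (t : ℕ) : Primrec fun n : ℕ => n ^ t :=
  Primrec.nat_pow.comp .id (.const t)

omit [Fintype M₂] [Fintype S₂] [Primcodable M₂] [Primcodable S₂] in
theorem primrecRel_admissible :
    PrimrecRel fun (l : K × ℕ) (I : DominoInstance M₁ S₁) =>
      R.Admissible I.2 l.1 (colouring I.1 l.2) := by
  have h1 : PrimrecRel fun (x : (S₁ × (M₁ × ℕ) × (M₁ × ℕ)) × (K × ℕ) × ℕ) (y : T × T) =>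
      ¬ (R.edge x.2.1.1 x.1.1 x.1.2.1.1 y.1 x.1.2.2.1 y.2 ∧
        colouring x.2.2 x.2.1.2 y.1 = x.1.2.1.2 ∧ colouring x.2.2 x.2.1.2 y.2 = x.1.2.2.2) := by
    refine PrimrecPred.not (PrimrecPred.and ?_ (PrimrecPred.and ?_ ?_))
    · exact PrimrecPred.of_finite
        (fun z : K × S₁ × M₁ × T × M₁ × T => R.edge z.1 z.2.1 z.2.2.1 z.2.2.2.1 z.2.2.2.2.1
          z.2.2.2.2.2)
        (f := fun z : ((S₁ × (M₁ × ℕ) × (M₁ × ℕ)) × (K × ℕ) × ℕ) × (T × T) =>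
          (z.1.2.1.1, z.1.1.1, z.1.1.2.1.1, z.2.1, z.1.1.2.2.1, z.2.2)) (by fun_prop)
    · exact Primrec.eq.comp (primrec_colouring (by fun_prop) (by fun_prop) (by fun_prop))
        (by fun_prop)
    · exact Primrec.eq.comp (primrec_colouring (by fun_prop) (by fun_prop) (by fun_prop))
        (by fun_prop)
  have h2 : PrimrecRel fun (r : S₁ × (M₁ × ℕ) × (M₁ × ℕ)) (y : (K × ℕ) × ℕ) =>
      ∀ i j, ¬ (R.edge y.1.1 r.1 r.2.1.1 i r.2.2.1 j ∧
        colouring y.2 y.1.2 i = r.2.1.2 ∧ colouring y.2 y.1.2 j = r.2.2.2) :=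
    (PrimrecPred.forall_finite h1).of_eq fun x => by simp [Prod.forall]
  exact PrimrecRel.comp (f := fun z : (K × ℕ) × DominoInstance M₁ S₁ => z.2.2)
    (g := fun z : (K × ℕ) × DominoInstance M₁ S₁ => (z.1, z.2.1)) h2.forall_mem_list
    (by fun_prop) (by fun_prop)

omit [Fintype M₂] [Fintype S₂] [Primcodable M₂] [Primcodable S₂] in
theorem primrec_letters : Primrec R.letters := by
  refine Primrec₂.comp (g := fun I : DominoInstance M₁ S₁ => (Finset.univ : Finset K).toList.flatMap
    fun k => (List.range (I.1 ^ Fintype.card T)).map fun e => (k, e)) (h := id)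
    R.primrecRel_admissible.listFilter ?_ Primrec.id
  have h0 : Primrec₂ fun (z : DominoInstance M₁ S₁ × K) (e : ℕ) => (z.2, e) :=
    Primrec.to₂ (f := fun y : (DominoInstance M₁ S₁ × K) × ℕ => (y.1.2, y.2)) (by fun_prop)
  have h1 : Primrec fun z : DominoInstance M₁ S₁ × K =>
      (List.range (z.1.1 ^ Fintype.card T)).map fun e => (z.2, e) :=
    Primrec.list_map (Primrec.list_range.comp ((primrec_pow_const _).comp
      (Primrec.fst.comp .fst))) h0
  exact Primrec.list_flatMap (.const _) h1.to₂

-- The quantifiers in `Forbidden` range over the list of letters, although the lookups already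
-- determine the two letters; as bounded quantifiers they preserve primitive recursiveness.
omit [Primcodable M₁] [Primcodable S₁] [Finite M₁] [Finite S₁] in
theorem primrecRel_forbidden :
    PrimrecRel fun (r : S₂ × (M₂ × ℕ) × (M₂ × ℕ)) (x : ℕ × List (K × ℕ)) =>
      R.Forbidden x.1 x.2 r := by
  have h1 : PrimrecRel fun (x : (K × ℕ) × (K × ℕ) × ℕ × (S₂ × (M₂ × ℕ) × (M₂ × ℕ)))
      (y : T × T) => R.glue x.2.2.2.1 y.1 y.2 →
        colouring x.2.2.1 x.1.2 y.1 = colouring x.2.2.1 x.2.1.2 y.2 := by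
    refine PrimrecPred.of_eq (PrimrecPred.or (PrimrecPred.not ?_) ?_) fun _ => imp_iff_not_or.symm
    · exact PrimrecPred.of_finite (fun z : S₂ × T × T => R.glue z.1 z.2.1 z.2.2)
        (f := fun z : ((K × ℕ) × (K × ℕ) × ℕ × (S₂ × (M₂ × ℕ) × (M₂ × ℕ))) × T × T =>
          (z.1.2.2.2.1, z.2.1, z.2.2)) (by fun_prop)
    · exact Primrec.eq.comp (primrec_colouring (by fun_prop) (by fun_prop) (by fun_prop))
        (primrec_colouring (by fun_prop) (by fun_prop) (by fun_prop))
  have h2 : PrimrecPred fun x : (K × ℕ) × (K × ℕ) × ℕ × (S₂ × (M₂ × ℕ) × (M₂ × ℕ)) =>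
      R.Compatible x.1.1 (colouring x.2.2.1 x.1.2) x.2.2.2.2.1.1 x.2.2.2.1 x.2.1.1
        (colouring x.2.2.1 x.2.1.2) := by
    refine PrimrecPred.and ?_ ((PrimrecPred.forall_finite h1).of_eq fun x => by simp [Prod.forall])
    exact PrimrecPred.of_finite (fun z : K × M₂ × S₂ × K => R.step z.1 z.2.1 z.2.2.1 z.2.2.2)
        (f := fun x : (K × ℕ) × (K × ℕ) × ℕ × (S₂ × (M₂ × ℕ) × (M₂ × ℕ)) =>
          (x.1.1, x.2.2.2.2.1.1, x.2.2.2.1, x.2.1.1)) (by fun_prop)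
  have h3 : PrimrecRel fun (b : K × ℕ)
      (z : (K × ℕ) × (S₂ × (M₂ × ℕ) × (M₂ × ℕ)) × (ℕ × List (K × ℕ))) =>
      z.2.2.2[z.2.1.2.1.2]? = some z.1 ∧ z.2.2.2[z.2.1.2.2.2]? = some b ∧
        ¬ R.Compatible z.1.1 (colouring z.2.2.1 z.1.2) z.2.1.2.1.1 z.2.1.1 b.1
          (colouring z.2.2.1 b.2) := by
    refine PrimrecPred.and ?_ (PrimrecPred.and ?_ (PrimrecPred.not ?_))
    · exact Primrec.eq.comp (Primrec.list_getElem?.comp (by fun_prop) (by fun_prop))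
        (Primrec.option_some.comp (by fun_prop))
    · exact Primrec.eq.comp (Primrec.list_getElem?.comp (by fun_prop) (by fun_prop))
        (Primrec.option_some.comp (by fun_prop))
    · exact h2.comp (f := fun z : (K × ℕ) ×
        ((K × ℕ) × (S₂ × (M₂ × ℕ) × (M₂ × ℕ)) × (ℕ × List (K × ℕ))) =>
          (z.2.1, z.1, z.2.2.2.1, z.2.2.1)) (by fun_prop)
  have h4 : PrimrecRel fun (a : K × ℕ)
      (z : (S₂ × (M₂ × ℕ) × (M₂ × ℕ)) × (ℕ × List (K × ℕ))) =>
      ∃ b ∈ z.2.2, z.2.2[z.1.2.1.2]? = some a ∧ z.2.2[z.1.2.2.2]? = some b ∧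
        ¬ R.Compatible a.1 (colouring z.2.1 a.2) z.1.2.1.1 z.1.1 b.1
          (colouring z.2.1 b.2) :=
    PrimrecRel.comp (f := fun z : (K × ℕ) × (S₂ × (M₂ × ℕ) × (M₂ × ℕ)) × (ℕ × List (K × ℕ)) =>
      z.2.2.2) (g := id) h3.exists_mem_list (by fun_prop) Primrec.id
  exact PrimrecRel.comp (f := fun z : (S₂ × (M₂ × ℕ) × (M₂ × ℕ)) × (ℕ × List (K × ℕ)) => z.2.2)
    (g := id) h4.exists_mem_list (by fun_prop) Primrec.id

theorem primrec_allPatterns :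
    Primrec (allPatterns : ℕ → List (S₂ × (M₂ × ℕ) × (M₂ × ℕ))) := by
  have h0 : Primrec₂ fun (z : (ℕ × S₂ × M₂ × M₂) × ℕ) (q : ℕ) =>
      (z.1.2.1, (z.1.2.2.1, z.2), (z.1.2.2.2, q)) :=
    Primrec.to₂ (f := fun y : ((ℕ × S₂ × M₂ × M₂) × ℕ) × ℕ =>
      (y.1.1.2.1, (y.1.1.2.2.1, y.1.2), (y.1.1.2.2.2, y.2))) (by fun_prop)
  have h1 : Primrec fun z : (ℕ × S₂ × M₂ × M₂) × ℕ => (List.range z.1.1).map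
        fun q => (z.1.2.1, (z.1.2.2.1, z.2), (z.1.2.2.2, q)) :=
    Primrec.list_map (Primrec.list_range.comp (Primrec.fst.comp .fst)) h0
  have h2 : Primrec fun z : ℕ × S₂ × M₂ × M₂ => (List.range z.1).flatMap fun p =>
      (List.range z.1).map fun q => (z.2.1, (z.2.2.1, p), (z.2.2.2, q)) :=
    Primrec.list_flatMap (Primrec.list_range.comp .fst) h1.to₂
  exact Primrec.list_flatMap (.const _) h2.to₂

theorem primrec_reduction : Primrec R.reduction := by
  have hlen : Primrec fun I => (R.letters I).length := Primrec.list_length.comp R.primrec_letters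
  have hf : Primrec₂ fun (l : List (S₂ × (M₂ × ℕ) × (M₂ × ℕ))) (x : ℕ × List (K × ℕ)) =>
      l.filter fun r => R.Forbidden x.1 x.2 r := R.primrecRel_forbidden.listFilter
  have hI : Primrec fun I => (I.1, R.letters I) := Primrec.pair .fst R.primrec_letters
  have ha : Primrec fun I => allPatterns (S₂ := S₂) (M₂ := M₂) (R.letters I).length :=
    primrec_allPatterns.comp hlen
  exact Primrec.pair hlen (hf.comp ha hI)

end

end SlotRules

namespace SlotRules

section
variable {M₁ S₁ M₂ S₂ K T : Type*} (R : SlotRules M₁ S₁ M₂ S₂ K T)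

-- A domino letter is a position in the list of letters, hence a pair of an element of `K` and a
-- colour code. Admissibility is built into the list, compatibility into the forbidden patterns.
open Classical in
theorem modelDominoProblem_reduction_iff [Fintype M₂] [Fintype S₂] [Fintype K] [Fintype T]
    (Γ : Blueprint M₂ S₂) (φ : List S₂ → Option M₂) (I : DominoInstance M₁ S₁) :
    Γ.ModelDominoProblem φ (R.reduction I) ↔ ∃ k c, R.Realizes Γ φ I k c := by
  constructor
  · rintro ⟨x, hx⟩
    rw [mem_modelSubshift_patterns] at hx
    obtain ⟨hsupp, hinv, hpat⟩ := hx
    have hlen : (R.reduction I).1 = (R.letters I).length := rfl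
    let l : Fin (R.reduction I).1 → K × ℕ := fun a => (R.letters I)[(a : ℕ)]'a.2
    have hl : ∀ a, l a ∈ R.letters I := fun a => List.getElem_mem _
    refine ⟨fun w => (x w).map fun a => (l a).1,
      fun w i => match x w with | none => 0 | some a => colouring I.1 (l a).2 i, ?_, ?_, ?_, ?_, ?_⟩
    · rw [← hsupp]; ext w; simp [optionSupport]
    · intro u hu v hv huv
      simp only [hinv u hu v hv huv, and_self]
    · intro w hw t
      rw [← hsupp] at hw
      obtain ⟨a, ha⟩ := Option.ne_none_iff_exists'.1 hw
      simp only [ha]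
      exact baseDigit_lt _ (Fintype.equivFin T t).2 (R.mem_letters.1 (hl a)).1
    · intro w k hk
      simp only [Option.map_eq_some_iff] at hk
      obtain ⟨a, ha, rfl⟩ := hk
      simp only [ha]
      exact (R.mem_letters.1 (hl a)).2
    · intro w s m k k' hm hk hk'
      simp only [Option.map_eq_some_iff] at hk hk'
      obtain ⟨a, ha, rfl⟩ := hk
      obtain ⟨b, hb, rfl⟩ := hk'
      simp only [ha, hb]
      have hws : w ++ [s] ∈ optionSupport φ := by
        rw [← hsupp]; simp [optionSupport, hb]
      obtain ⟨m', hm'⟩ := Option.ne_none_iff_exists'.1 hws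
      have := hpat w s m m' a b hm hm' ha hb
      rw [mem_reduction] at this
      by_contra hcon
      exact this ⟨l a, hl a, l b, hl b, List.getElem?_eq_getElem _, List.getElem?_eq_getElem _, hcon⟩
  · rintro ⟨k, c, hsupp, hinv, hlt, hadm, hcomp⟩
    -- `Q` depends on the word only through its `K`-part and its colours. The position chosen from
    -- `Q` below is therefore the same at equivalent words.
    let Q : K → (T → ℕ) → Fin (R.reduction I).1 → Prop := fun a d p =>
      ∃ e, (R.letters I)[(p : ℕ)]? = some (a, e) ∧ colouring I.1 e = d
    have hQ : ∀ w a, k w = some a → ∃ p, Q a (c w) p := by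
      intro w a ha
      have hw : w ∈ optionSupport φ := by rw [← hsupp]; simp [optionSupport, ha]
      obtain ⟨e, he, hc⟩ := exists_baseDigit_eq
        (fun i => c w ((Fintype.equivFin T).symm i)) (fun i => hlt w hw _)
      have hc' : colouring I.1 e = c w := by
        funext t
        simpa [colouring, slotIndex] using hc (Fintype.equivFin T t)
      have hmem : (a, e) ∈ R.letters I := by
        rw [mem_letters]
        exact ⟨he, by rw [hc']; exact hadm w a ha⟩
      obtain ⟨p, hp, hpe⟩ := List.getElem_of_mem hmem
      exact ⟨⟨p, hp⟩, e, by rw [List.getElem?_eq_getElem hp, hpe], hc'⟩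
    let x : List S₂ → Option (Fin (R.reduction I).1) := fun w =>
      (k w).bind fun a => if h : ∃ p, Q a (c w) p then some h.choose else none
    have hx : ∀ w p, x w = some p → ∃ a, k w = some a ∧ Q a (c w) p := by
      intro w p hp
      simp only [x, Option.bind_eq_some_iff] at hp
      obtain ⟨a, ha, hp⟩ := hp
      split_ifs at hp with h
      cases hp
      exact ⟨a, ha, h.choose_spec⟩
    refine ⟨x, (mem_modelSubshift_patterns _ _ _ _).2 ⟨?_, ?_, ?_⟩⟩
    · rw [← hsupp]
      ext w
      simp only [optionSupport, Set.mem_ofPred_eq, Option.ne_none_iff_exists']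
      constructor
      · rintro ⟨p, hp⟩
        obtain ⟨a, ha, -⟩ := hx w p hp
        exact ⟨a, ha⟩
      · rintro ⟨a, ha⟩
        have := hQ w a ha
        exact ⟨this.choose, by simp [x, ha, dif_pos this]⟩
    · intro u hu v hv huv
      obtain ⟨h1, h2⟩ := hinv u hu v hv huv
      simp only [x, h1, h2]
    · intro w s m m' p q hm hm' hp hq
      obtain ⟨a, ha, e, hae, hec⟩ := hx w p hp
      obtain ⟨b, hb, f, hbf, hfc⟩ := hx _ q hq
      rw [mem_reduction]
      rintro ⟨a', -, b', -, ha', hb', hcon⟩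
      rw [hae] at ha'
      rw [hbf] at hb'
      cases ha'
      cases hb'
      refine hcon ?_
      simp only [hec, hfc]
      exact hcomp w s m a b hm ha hb

end

theorem exists_computable {M₁ S₁ M₂ S₂ K T : Type*} [Primcodable M₁] [Primcodable S₁]
    [Primcodable M₂] [Primcodable S₂] [Finite M₁] [Finite S₁] [Finite M₂] [Finite S₂]
    [Finite K] [Finite T] (R : SlotRules M₁ S₁ M₂ S₂ K T)
    (Γ : Blueprint M₂ S₂) (φ : List S₂ → Option M₂) :
    ∃ g : DominoInstance M₁ S₁ → DominoInstance M₂ S₂, Computable g ∧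
      ∀ I, Γ.ModelDominoProblem φ (g I) ↔ ∃ k c, R.Realizes Γ φ I k c := by
  have := Fintype.ofFinite M₂
  have := Fintype.ofFinite S₂
  have := Fintype.ofFinite K
  have := Fintype.ofFinite T
  let _ : Primcodable K := Primcodable.ofEquiv _ (Fintype.equivFin K)
  let _ : Primcodable T := Primcodable.ofEquiv _ (Fintype.equivFin T)
  exact ⟨R.reduction, R.primrec_reduction.to_comp, R.modelDominoProblem_reduction_iff Γ φ⟩

end SlotRules

/-! ### Models, their shifts, and the action of words on vertices. -/

/-- `φ` shifted by the word `w`. -/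
def shiftBy {S X : Type*} (φ : List S → X) (w : List S) : List S → X := fun u => φ (w ++ u)

namespace Blueprint

variable {M S : Type*} {Γ : Blueprint M S} {φ : List S → Option M}

theorem ConsistentMap.apply_append_singleton_ne_none (h : Γ.ConsistentMap φ) {w : List S} {s : S} :
    w ++ [s] ∈ optionSupport φ ↔ φ w = some (Γ.init s) := by
  constructor
  · intro hw
    by_contra hcon
    exact hw ((h.2 w s).2 hcon)
  · intro hw
    obtain ⟨m, -, hm⟩ := (h.2 w s).1 hw
    simp [optionSupport, hm]

theorem ConsistentMap.mem_of_append (h : Γ.ConsistentMap φ) {w u : List S}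
    (hw : w ++ u ∈ optionSupport φ) : w ∈ optionSupport φ := by
  induction u using List.reverseRecOn with
  | nil => simpa using hw
  | append_singleton u s ih =>
    rw [← List.append_assoc, h.apply_append_singleton_ne_none] at hw
    exact ih (by simp [optionSupport, hw])

theorem ConsistentMap.consistentWord (h : Γ.ConsistentMap φ) {w : List S}
    (hw : w ∈ optionSupport φ) : Γ.ConsistentWord w := by
  induction w using List.reverseRecOn with
  | nil => exact List.isChain_nil
  | append_singleton w s ih =>
    have hw' := h.mem_of_append hw
    rw [h.apply_append_singleton_ne_none] at hw
    refine List.isChain_append.2 ⟨ih hw', List.isChain_singleton _, ?_⟩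
    intro a ha b hb
    simp only [List.head?_cons, Option.mem_def, Option.some.injEq] at hb
    subst hb
    obtain ⟨w₀, rfl⟩ : ∃ w₀, w = w₀ ++ [a] := by
      obtain ⟨w₀, h₀⟩ := List.getLast?_eq_some_iff.1 ha
      exact ⟨w₀, h₀⟩
    obtain ⟨m, hm, hm'⟩ := (h.2 w₀ a).1 (h.apply_append_singleton_ne_none.1 hw')
    rw [hm'] at hw
    cases hw
    exact hm

theorem ConsistentMap.shiftBy (h : Γ.ConsistentMap φ) {w : List S} (hw : w ∈ optionSupport φ) :
    Γ.ConsistentMap (shiftBy φ w) := by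
  refine ⟨?_, fun u s => ?_⟩
  · change φ (w ++ []) ≠ none
    rw [List.append_nil]
    exact hw
  · have := h.2 (w ++ u) s
    simpa [_root_.shiftBy, List.append_assoc] using this

/-- `u` and `v` lie in the support of `φ` and represent the same vertex of its model graph. -/
def SameVertex (Γ : Blueprint M S) (φ : List S → Option M) (u v : List S) : Prop :=
  u ∈ optionSupport φ ∧ v ∈ optionSupport φ ∧ Γ.Equivalent u v

theorem SameVertex.symm {u v : List S} (h : Γ.SameVertex φ u v) : Γ.SameVertex φ v u :=
  ⟨h.2.1, h.1, h.2.2.symm⟩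

theorem SameVertex.trans {u v w : List S} (h : Γ.SameVertex φ u v) (h' : Γ.SameVertex φ v w) :
    Γ.SameVertex φ u w :=
  ⟨h.1, h'.2.1, h.2.2.trans _ _ _ h'.2.2⟩

theorem SameVertex.refl {u : List S} (h : u ∈ optionSupport φ) : Γ.SameVertex φ u u :=
  ⟨h, h, .refl _⟩

theorem similar_append {u v z : List S} (h : Γ.Similar u v) (hu : Γ.ConsistentWord (u ++ z))
    (hv : Γ.ConsistentWord (v ++ z)) : Γ.Similar (u ++ z) (v ++ z) := by
  obtain ⟨-, -, r, hr, x, y, rfl, rfl⟩ := h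
  exact ⟨hu, hv, r, hr, x, y ++ z, by simp, by simp⟩

theorem similar_prepend {u v z : List S} (h : Γ.Similar u v) (hu : Γ.ConsistentWord (z ++ u))
    (hv : Γ.ConsistentWord (z ++ v)) : Γ.Similar (z ++ u) (z ++ v) := by
  obtain ⟨-, -, r, hr, x, y, rfl, rfl⟩ := h
  exact ⟨hu, hv, r, hr, z ++ x, y, by simp, by simp⟩

/-- In a coherent blueprint, it suffices to test the relations at similar words. -/
theorem Coherent.mem_modelSpace (hc : Γ.Coherent) (h : Γ.ConsistentMap φ)
    (hs : ∀ u ∈ optionSupport φ, ∀ v ∈ optionSupport φ, Γ.Similar u v → φ u = φ v) :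
    φ ∈ Γ.modelSpace := by
  refine ⟨h, fun u hu v hv huv => ?_⟩
  have := hc φ h hs u hu v hv huv
  clear hu hv huv
  induction this with
  | rel a b hab => exact hs a hab.1 b hab.2.1 hab.2.2
  | refl => rfl
  | symm _ _ _ ih => exact ih.symm
  | trans _ _ _ _ _ ih₁ ih₂ => exact ih₁.trans ih₂

theorem eq_of_similar (h : φ ∈ Γ.modelSpace) {u v : List S} (hu : u ∈ optionSupport φ)
    (hv : v ∈ optionSupport φ) (huv : Γ.Similar u v) : φ u = φ v :=
  h.2 u hu v hv (.rel _ _ huv)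

theorem SameVertex.eq (h : φ ∈ Γ.modelSpace) {u v : List S} (huv : Γ.SameVertex φ u v) :
    φ u = φ v :=
  h.2 u huv.1 v huv.2.1 huv.2.2

/-- Equivalent words of the support of a model are joined inside the support. -/
theorem SameVertex.chain (hc : Γ.Coherent) (h : φ ∈ Γ.modelSpace) {u v : List S}
    (huv : Γ.SameVertex φ u v) :
    Relation.EqvGen
      (fun a b => a ∈ optionSupport φ ∧ b ∈ optionSupport φ ∧ Γ.Similar a b) u v :=
  hc φ h.1 (fun _ hu _ hv => eq_of_similar h hu hv) u huv.1 v huv.2.1 huv.2.2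

theorem shiftBy_mem_modelSpace (hc : Γ.Coherent) (h : φ ∈ Γ.modelSpace) {w : List S}
    (hw : w ∈ optionSupport φ) : shiftBy φ w ∈ Γ.modelSpace := by
  refine hc.mem_modelSpace (h.1.shiftBy hw) fun u hu v hv huv => ?_
  exact eq_of_similar h hu hv (similar_prepend huv (h.1.consistentWord hu) (h.1.consistentWord hv))

theorem SameVertex.prepend (hc : Γ.Coherent) (h : φ ∈ Γ.modelSpace) {w u v : List S}
    (hw : w ∈ optionSupport φ) (huv : Γ.SameVertex (shiftBy φ w) u v) :
    Γ.SameVertex φ (w ++ u) (w ++ v) := by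
  refine ⟨huv.1, huv.2.1, ?_⟩
  have := huv.chain hc (shiftBy_mem_modelSpace hc h hw)
  clear huv
  induction this with
  | rel a b hab =>
    exact .rel _ _ (similar_prepend hab.2.2 (h.1.consistentWord hab.1) (h.1.consistentWord hab.2.1))
  | refl => exact .refl _
  | symm _ _ _ ih => exact ih.symm
  | trans _ _ _ _ _ ih₁ ih₂ => exact ih₁.trans _ _ _ ih₂

theorem apply_append_of_similar (h : φ ∈ Γ.modelSpace) {u v : List S} (hu : u ∈ optionSupport φ)
    (hv : v ∈ optionSupport φ) (huv : Γ.Similar u v) (z : List S) : φ (u ++ z) = φ (v ++ z) := by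
  induction z using List.reverseRecOn with
  | nil => simpa using eq_of_similar h hu hv huv
  | append_singleton z s ih =>
    rw [← List.append_assoc, ← List.append_assoc]
    by_cases hz : φ (u ++ z) = some (Γ.init s)
    · have h1 := h.1.apply_append_singleton_ne_none.2 hz
      have h2 := h.1.apply_append_singleton_ne_none.2 (ih ▸ hz)
      refine eq_of_similar h h1 h2 ?_
      have h1' := h.1.consistentWord h1
      have h2' := h.1.consistentWord h2
      rw [List.append_assoc] at h1' h2' ⊢
      rw [List.append_assoc]
      exact similar_append huv h1' h2'
    · rw [(h.1.2 _ s).2 hz, (h.1.2 _ s).2 (ih ▸ hz)]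

theorem SameVertex.apply_append (hc : Γ.Coherent) (h : φ ∈ Γ.modelSpace) {u v : List S}
    (huv : Γ.SameVertex φ u v) (z : List S) : φ (u ++ z) = φ (v ++ z) := by
  have := huv.chain hc h
  clear huv
  induction this with
  | rel a b hab => exact apply_append_of_similar h hab.1 hab.2.1 hab.2.2 z
  | refl => rfl
  | symm _ _ _ ih => exact ih.symm
  | trans _ _ _ _ _ ih₁ ih₂ => exact ih₁.trans ih₂

/-- Equivalence alone could pass through words that leave the support. Coherence supplies a chain
inside the support, along which `z` is appended link by link. -/
theorem SameVertex.append (hc : Γ.Coherent) (h : φ ∈ Γ.modelSpace) {u v z : List S}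
    (huv : Γ.SameVertex φ u v) (hz : u ++ z ∈ optionSupport φ) :
    Γ.SameVertex φ (u ++ z) (v ++ z) := by
  have hz' : v ++ z ∈ optionSupport φ := by
    simpa [optionSupport, huv.apply_append hc h z] using hz
  refine ⟨hz, hz', ?_⟩
  have aux : ∀ a b, Relation.EqvGen
      (fun a b => a ∈ optionSupport φ ∧ b ∈ optionSupport φ ∧ Γ.Similar a b) a b →
      (a ++ z ∈ optionSupport φ ↔ b ++ z ∈ optionSupport φ) ∧
        (a ++ z ∈ optionSupport φ → Γ.Equivalent (a ++ z) (b ++ z)) := by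
    intro a b hab
    induction hab with
    | rel a b hab =>
      have he := apply_append_of_similar h hab.1 hab.2.1 hab.2.2 z
      refine ⟨by simp [optionSupport, he], fun ha => ?_⟩
      have hb : b ++ z ∈ optionSupport φ := by simpa [optionSupport, he] using ha
      exact .rel _ _ (similar_append hab.2.2 (h.1.consistentWord ha) (h.1.consistentWord hb))
    | refl => exact ⟨Iff.rfl, fun _ => .refl _⟩
    | symm _ _ _ ih => exact ⟨ih.1.symm, fun ha => (ih.2 (ih.1.2 ha)).symm⟩
    | trans _ _ _ _ _ ih₁ ih₂ =>
      exact ⟨ih₁.1.trans ih₂.1, fun ha => (ih₁.2 ha).trans _ _ _ (ih₂.2 (ih₁.1.1 ha))⟩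
  exact (aux u v (huv.chain hc h)).2 hz

/-- The vertex represented by a word of the support. -/
def vertexOf (Γ : Blueprint M S) (φ : List S → Option M) (w : List S) (hw : w ∈ optionSupport φ) :
    Γ.vertices φ :=
  ⟨Quotient.mk Γ.equivalence w, w, hw, rfl⟩

theorem vertexOf_eq_iff {u v : List S} {hu : u ∈ optionSupport φ} {hv : v ∈ optionSupport φ} :
    Γ.vertexOf φ u hu = Γ.vertexOf φ v hv ↔ Γ.SameVertex φ u v := by
  simp only [SameVertex, hu, hv, true_and]
  exact Subtype.ext_iff.trans Quotient.eq

theorem exists_vertexOf (a : Γ.vertices φ) : ∃ w hw, a = Γ.vertexOf φ w hw := by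
  obtain ⟨_, w, hw, rfl⟩ := a
  exact ⟨w, hw, rfl⟩

theorem edge_append {w : List S} {s : S} (hm : φ w = some (Γ.init s))
    (hw : w ∈ optionSupport φ) (hws : w ++ [s] ∈ optionSupport φ) :
    Γ.Edge φ (Γ.vertexOf φ w hw) (Γ.vertexOf φ (w ++ [s]) hws) :=
  ⟨s, w, hw, hm, rfl, rfl⟩

/-- Directed paths are followed by words. -/
theorem exists_word_of_path (hc : Γ.Coherent) (h : φ ∈ Γ.modelSpace) {w : List S}
    (hw : w ∈ optionSupport φ) {n : ℕ} {b : Γ.vertices φ}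
    (hp : HasDirectedPath (Γ.Edge φ) n (Γ.vertexOf φ w hw) b) :
    ∃ u : List S, u.length = n ∧ ∃ hu : w ++ u ∈ optionSupport φ, b = Γ.vertexOf φ (w ++ u) hu := by
  obtain ⟨v, h0, hn, hv⟩ := hp
  subst hn
  induction n with
  | zero => exact ⟨[], rfl, by simpa using hw, by simp [h0]⟩
  | succ n ih =>
    obtain ⟨u, hlen, hu, he⟩ := ih fun k hk => hv k (by omega)
    obtain ⟨s, x, hx, hxs, h1, h2⟩ := hv n (by omega)
    rw [he] at h1
    have hxu : Γ.SameVertex φ x (w ++ u) :=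
      ⟨hx, hu, (Quotient.exact h1).symm⟩
    have hxs' : x ++ [s] ∈ optionSupport φ := h.1.apply_append_singleton_ne_none.2 hxs
    have := hxu.append hc h hxs'
    rw [List.append_assoc] at this
    exact ⟨u ++ [s], by simp [hlen], this.2.1, Subtype.ext (h2.trans (Quotient.sound this.2.2))⟩

theorem exists_word_of_dist_le (hc : Γ.Coherent) (hs : Γ.StronglyConnected) (h : φ ∈ Γ.modelSpace)
    {w : List S} (hw : w ∈ optionSupport φ) {r : ℝ} {b : Γ.vertices φ}
    (hr : Γ.modelDist φ (Γ.vertexOf φ w hw) b ≤ r) :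
    ∃ u : List S, u.length ≤ r ∧ ∃ hu : w ++ u ∈ optionSupport φ,
      b = Γ.vertexOf φ (w ++ u) hu := by
  obtain ⟨u, hlen, hu⟩ := exists_word_of_path hc h hw
    (Nat.sInf_mem (s := {n | HasDirectedPath (Γ.Edge φ) n (Γ.vertexOf φ w hw) b}) (hs φ h _ b))
  exact ⟨u, by rw [hlen]; exact hr, hu⟩

theorem exists_return (hc : Γ.Coherent) (hs : Γ.StronglyConnected) (h : φ ∈ Γ.modelSpace)
    {w : List S} (hw : w ∈ optionSupport φ) : ∃ v, Γ.SameVertex φ (w ++ v) [] := by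
  have h0 : [] ∈ optionSupport φ := h.1.1
  obtain ⟨n, hn⟩ := hs φ h (Γ.vertexOf φ w hw) (Γ.vertexOf φ [] h0)
  obtain ⟨v, -, hv, he⟩ := exists_word_of_path hc h hw hn
  exact ⟨v, (vertexOf_eq_iff.1 he).symm⟩

/-- Words of the supports of models may be cancelled on the left. -/
theorem SameVertex.cancel (hc : Γ.Coherent) (hs : Γ.StronglyConnected) (h : φ ∈ Γ.modelSpace)
    {w u u' : List S} (hu : Γ.SameVertex φ (w ++ u) (w ++ u')) :
    Γ.SameVertex (shiftBy φ w) u u' := by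
  have hw := h.1.mem_of_append hu.1
  have hψ := shiftBy_mem_modelSpace hc h hw
  -- The word `v` leads from `w` back to the origin of `φ`, and `v'` leads from `v` back to the
  -- origin of the shifted model. Thus `v'` starts at the origin of `φ` and reaches the vertex of
  -- `w`, while `v ++ v'` is a loop in the shifted model.
  obtain ⟨v, hv⟩ := exists_return hc hs h hw
  obtain ⟨v', hv'⟩ := exists_return hc hs hψ (w := v) hv.1
  have key : ∀ z, w ++ z ∈ optionSupport φ →
      Γ.SameVertex (shiftBy φ w) (v ++ (v' ++ z)) z ∧ Γ.SameVertex φ (v' ++ z) (w ++ z) := by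
    intro z hz
    have h1 := hv'.symm.append hc hψ (z := z) hz
    simp only [List.nil_append, List.append_assoc] at h1
    refine ⟨h1.symm, ?_⟩
    have h2 : Γ.SameVertex φ (w ++ (v ++ (v' ++ z))) (w ++ z) := h1.symm.prepend hc h hw
    have h3 := hv.append hc h (z := v' ++ z) (by simpa using h2.1)
    simp only [List.nil_append, List.append_assoc] at h3
    exact h3.symm.trans h2
  obtain ⟨h1, h2⟩ := key u hu.1
  obtain ⟨h1', h2'⟩ := key u' hu.2.1
  have h3 : Γ.SameVertex φ (v' ++ u) (v' ++ u') := h2.trans (hu.trans h2'.symm)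
  -- Since `v` returns to the origin, `φ` is itself a shift of `shiftBy φ w`. An equivalence in `φ`
  -- can thus be prepended with `v` to give one in the shifted model, where the loop `v ++ v'` is
  -- then removed.
  have hφ : shiftBy (shiftBy φ w) v = φ := by
    funext z
    have := hv.apply_append hc h z
    simpa [_root_.shiftBy] using this
  have h4 : Γ.SameVertex (shiftBy φ w) (v ++ (v' ++ u)) (v ++ (v' ++ u')) :=
    SameVertex.prepend hc hψ hv.1 (by rw [hφ]; exact h3)
  exact h1.symm.trans (h4.trans h1')

/-- If some vertex has no outgoing edge, then there is only one vertex. -/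
theorem eq_of_no_edge (hc : Γ.Coherent) (hs : Γ.StronglyConnected) (h : φ ∈ Γ.modelSpace)
    {w : List S} (hw : w ∈ optionSupport φ) (hno : ∀ s, φ w ≠ some (Γ.init s)) {u : List S}
    (hu : u ∈ optionSupport φ) : φ u = φ w := by
  obtain ⟨v, hv⟩ := exists_return hc hs h hw
  have hno' : ∀ z, w ++ z ∈ optionSupport φ → z = [] := by
    intro z hz
    cases z with
    | nil => rfl
    | cons s z =>
      have : w ++ [s] ∈ optionSupport φ := h.1.mem_of_append (u := z) (by simpa using hz)
      exact absurd (h.1.apply_append_singleton_ne_none.1 this) (hno s)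
  -- The return path from a dead end is empty, so the dead end is the origin, and every `u` in the
  -- support can be read from it.
  obtain rfl := hno' v hv.1
  have h1 := hv.symm.append hc h (z := u) (by simpa using hu)
  simp only [List.append_nil, List.nil_append] at h1
  obtain rfl := hno' u h1.2.1
  simpa using h1.eq h

end Blueprint

/-! ### Rules on windows of bounded size, reduced to nearest neighbor rules. -/

/-- `κ` restricted to words of length at most `L`. -/
def truncate {S X : Type*} (L : ℕ) (κ : List S → Option X) : List S → Option X :=
  fun u => if u.length ≤ L then κ u else none

/-- The words of length at most `L`. -/
abbrev ShortWord (S : Type*) (L : ℕ) : Type _ := {u : List S // u.length ≤ L}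

instance ShortWord.finite (S : Type*) [Finite S] (L : ℕ) : Finite (ShortWord S L) :=
  (List.finite_length_le S L).to_subtype

/-- A window, extended by `none`. -/
def extendWindow {S X : Type*} {L : ℕ} (k : ShortWord S L → Option X) : List S → Option X :=
  fun u => if h : u.length ≤ L then k ⟨u, h⟩ else none

/-- Constraints on windows of size `L`: a set of allowed windows, and pairs of slots of which the
colours are constrained by the patterns of a domino instance. -/
structure WindowRules (M₁ S₁ S₂ B J : Type*) where
  allowed : Set (List S₂ → Option B)
  edge : (List S₂ → Option B) → S₁ → M₁ → J → M₁ → List S₂ → J → Prop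

namespace WindowRules

variable {M₁ S₁ M₂ S₂ B J : Type*} (W : WindowRules M₁ S₁ S₂ B J) (L : ℕ)

/-- The configurations of which all windows obey the rules. -/
def Realizes (Γ : Blueprint M₂ S₂) (φ : List S₂ → Option M₂) (I : DominoInstance M₁ S₁)
    (κ : List S₂ → Option B) (c : List S₂ → J → ℕ) : Prop :=
  optionSupport κ = optionSupport φ ∧
  (∀ u v, Γ.SameVertex φ u v → κ u = κ v ∧ c u = c v) ∧
  (∀ w ∈ optionSupport φ, ∀ j, c w j < I.1) ∧
  (∀ w ∈ optionSupport φ, truncate L (shiftBy κ w) ∈ W.allowed) ∧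
  ∀ w ∈ optionSupport φ, ∀ s m i m' u j, u.length ≤ L → w ++ u ∈ optionSupport φ →
    W.edge (truncate L (shiftBy κ w)) s m i m' u j →
    (s, (m, c w i), (m', c (w ++ u) j)) ∉ I.2

/-- The windows which may occur, together with the states of the model. -/
structure IsWindow (Γ : Blueprint M₂ S₂) (φ : List S₂ → Option M₂)
    (k : ShortWord S₂ L → Option (M₂ × B)) : Prop where
  center : ∃ m b, extendWindow k [] = some (m, b) ∧ ∃ w, φ w = some m
  init : ∀ s u, extendWindow k (s :: u) ≠ none → ∃ b, extendWindow k [] = some (Γ.init s, b)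
  allowed : (fun u => (extendWindow k u).map Prod.snd) ∈ W.allowed

/-- Letters store windows; neighboring letters have to agree on the intersection. -/
def slotRules (Γ : Blueprint M₂ S₂) (φ : List S₂ → Option M₂) :
    SlotRules M₁ S₁ M₂ S₂ {k // W.IsWindow L Γ φ k} (ShortWord S₂ L × J) where
  edge k s m i m' j := i.1.1 = [] ∧ extendWindow k.1 j.1.1 ≠ none ∧
    W.edge (fun u => (extendWindow k.1 u).map Prod.snd) s m i.2 m' j.1.1 j.2
  step k m s k' := (∃ b, extendWindow k.1 [] = some (m, b)) ∧
    ∀ u : List S₂, u.length < L → extendWindow k.1 (s :: u) = extendWindow k'.1 u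
  glue s i j := i.1.1 = s :: j.1.1 ∧ i.2 = j.2

variable {W L} {Γ : Blueprint M₂ S₂} {φ : List S₂ → Option M₂}

/-- Stored windows are truthful: following `u` one letter at a time, agreement on overlaps
identifies the entry and the colours at `u` with those at the center of the letter at `w ++ u`. -/
theorem extendWindow_eq_of_realizes (hc : Γ.Coherent) (hs : Γ.StronglyConnected)
    (hφ : φ ∈ Γ.modelSpace) {I : DominoInstance M₁ S₁}
    {k : List S₂ → Option {k // W.IsWindow L Γ φ k}} {c : List S₂ → ShortWord S₂ L × J → ℕ}
    (h : (W.slotRules L Γ φ).Realizes Γ φ I k c) (u : List S₂) (hu : u.length ≤ L) :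
    ∀ w a, k w = some a →
      (extendWindow a.1 u = Option.map₂ Prod.mk (φ (w ++ u))
        ((k (w ++ u)).bind fun a => (extendWindow a.1 []).map Prod.snd)) ∧
      (w ++ u ∈ optionSupport φ → ∀ j, c w (⟨u, hu⟩, j) = c (w ++ u) (⟨[], by simp⟩, j)) := by
  obtain ⟨hsupp, -, -, -, hstep⟩ := h
  have hmem : ∀ w, w ∈ optionSupport φ ↔ ∃ a, k w = some a := fun w => by
    rw [← hsupp]; exact Option.ne_none_iff_exists'
  have hcenter : ∀ w a, k w = some a → ∃ m b, φ w = some m ∧ extendWindow a.1 [] = some (m, b) := by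
    intro w a ha
    have hw := (hmem w).2 ⟨a, ha⟩
    -- The patterns compare the stored state with `φ` only along outgoing edges. Without such an
    -- edge `φ` takes a single value on its support, and `IsWindow.center` forces the stored state
    -- to be a value of `φ`.
    by_cases hno : ∃ s, φ w = some (Γ.init s)
    · obtain ⟨s, hws⟩ := hno
      obtain ⟨a', ha'⟩ := (hmem _).1 (hφ.1.apply_append_singleton_ne_none.2 hws)
      obtain ⟨b, hb⟩ := (hstep w s _ a a' hws ha ha').1.1
      exact ⟨_, b, hws, hb⟩
    · push Not at hno
      obtain ⟨m, b, hb, v, hv⟩ := a.2.center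
      have hv' : v ∈ optionSupport φ := fun h => by rw [h] at hv; cases hv
      exact ⟨m, b, by rw [← Blueprint.eq_of_no_edge hc hs hφ hw hno hv', hv], hb⟩
  induction u with
  | nil =>
    intro w a ha
    obtain ⟨m, b, hm, hb⟩ := hcenter w a ha
    simp [ha, hm, hb]
  | cons s u ih =>
    intro w a ha
    have hu' : u.length < L := by simpa using hu
    by_cases hws : φ w = some (Γ.init s)
    · obtain ⟨a', ha'⟩ := (hmem _).1 (hφ.1.apply_append_singleton_ne_none.2 hws)
      obtain ⟨h1, h2⟩ := hstep w s _ a a' hws ha ha'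
      obtain ⟨h3, h4⟩ := ih hu'.le _ _ ha'
      simp only [List.append_assoc, List.singleton_append] at h3 h4
      refine ⟨by rw [h1.2 u hu', h3], fun hmem j => ?_⟩
      rw [← h4 hmem j]
      exact h2 _ _ ⟨rfl, rfl⟩
    · have hnot : w ++ s :: u ∉ optionSupport φ := fun hcon =>
        hws (hφ.1.apply_append_singleton_ne_none.1 (hφ.1.mem_of_append (u := u) (by simpa using hcon)))
      have hnone : φ (w ++ s :: u) = none := not_not.1 hnot
      refine ⟨?_, fun hcon => absurd hcon hnot⟩
      rw [hnone]
      simp only [Option.map₂_none_left]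
      by_contra hcon
      -- No neighboring letter exists along `s` here, so only `IsWindow.init` can rule out a
      -- spurious entry at `s :: u`.
      obtain ⟨b, hb⟩ := a.2.init s u hcon
      obtain ⟨m, b', hm, hb'⟩ := hcenter w a ha
      rw [hb] at hb'
      cases hb'
      exact hws hm

theorem realizes_of_slotRules (hc : Γ.Coherent) (hs : Γ.StronglyConnected)
    (hφ : φ ∈ Γ.modelSpace) {I : DominoInstance M₁ S₁}
    {k : List S₂ → Option {k // W.IsWindow L Γ φ k}} {c : List S₂ → ShortWord S₂ L × J → ℕ}
    (h : (W.slotRules L Γ φ).Realizes Γ φ I k c) :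
    W.Realizes L Γ φ I (fun w => (k w).bind fun a => (extendWindow a.1 []).map Prod.snd)
      (fun w j => c w (⟨[], by simp⟩, j)) := by
  have key := extendWindow_eq_of_realizes hc hs hφ h
  obtain ⟨hsupp, hinv, hlt, hadm, -⟩ := h
  set κ : List S₂ → Option B := fun w => (k w).bind fun a => (extendWindow a.1 []).map Prod.snd
    with hκ
  have hmem : ∀ w, w ∈ optionSupport φ ↔ ∃ a, k w = some a := fun w => by
    rw [← hsupp]; exact Option.ne_none_iff_exists'
  have hsupp' : optionSupport κ = optionSupport φ := by
    ext w
    rw [hmem]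
    refine Option.ne_none_iff_exists'.trans ⟨?_, ?_⟩
    · rintro ⟨b, hb⟩
      obtain ⟨a, ha, -⟩ := Option.bind_eq_some_iff.1 hb
      exact ⟨a, ha⟩
    · rintro ⟨a, ha⟩
      obtain ⟨m, b, hb, -⟩ := a.2.center
      exact ⟨b, by simp [hκ, ha, hb]⟩
  have hwin : ∀ w a, k w = some a →
      truncate L (shiftBy κ w) = fun u => (extendWindow a.1 u).map Prod.snd := by
    intro w a ha
    funext u
    by_cases hu : u.length ≤ L
    · rw [(key u hu w a ha).1]
      simp only [truncate, hu, if_true, shiftBy]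
      by_cases hwu : w ++ u ∈ optionSupport φ
      · obtain ⟨m, hm⟩ := Option.ne_none_iff_exists'.1 hwu
        obtain ⟨b, hb⟩ := Option.ne_none_iff_exists'.1 (hsupp' ▸ hwu : w ++ u ∈ optionSupport κ)
        have hb' := hb
        simp only [hκ] at hb'
        rw [hb, hm, hb']
        rfl
      · have h1 : κ (w ++ u) = none := by
          by_contra hcon
          exact hwu (hsupp' ▸ hcon)
        have h2 : φ (w ++ u) = none := not_not.1 hwu
        rw [h1, h2]
        rfl
    · simp [truncate, extendWindow, hu]
  refine ⟨hsupp', ?_, fun w hw j => hlt w hw _, ?_, ?_⟩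
  · rintro u v ⟨hu, hv, huv⟩
    obtain ⟨h1, h2⟩ := hinv u hu v hv huv
    simp only [hκ, h1, h2, and_self]
  · intro w hw
    obtain ⟨a, ha⟩ := (hmem w).1 hw
    rw [hwin w a ha]
    exact a.2.allowed
  · intro w hw s m i m' u j hu hwu hE hI
    obtain ⟨a, ha⟩ := (hmem w).1 hw
    rw [hwin w a ha] at hE
    refine hadm w a ha _ hI (⟨[], by simp⟩, i) (⟨u, hu⟩, j) ⟨⟨rfl, ?_, hE⟩, rfl, ?_⟩
    · rw [(key u hu w a ha).1]
      obtain ⟨m, hm⟩ := Option.ne_none_iff_exists'.1 hwu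
      obtain ⟨b, hb⟩ := Option.ne_none_iff_exists'.1 (hsupp' ▸ hwu : w ++ u ∈ optionSupport κ)
      simp only [hκ] at hb
      rw [hm, hb]
      simp
    · exact (key u hu w a ha).2 hwu j

open Classical in
theorem exists_slotRules_realizes (hc : Γ.Coherent) (hφ : φ ∈ Γ.modelSpace)
    {I : DominoInstance M₁ S₁} {κ : List S₂ → Option B} {c : List S₂ → J → ℕ}
    (h : W.Realizes L Γ φ I κ c) : ∃ k c, (W.slotRules L Γ φ).Realizes Γ φ I k c := by
  obtain ⟨hsupp, hinv, hlt, hall, hedge⟩ := h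
  have hκ : ∀ w, κ w = none ↔ φ w = none := fun w => by
    have : w ∈ optionSupport κ ↔ w ∈ optionSupport φ := by rw [hsupp]
    exact not_iff_not.1 this
  let win : List S₂ → ShortWord S₂ L → Option (M₂ × B) := fun w u =>
    Option.map₂ Prod.mk (φ (w ++ u.1)) (κ (w ++ u.1))
  have hext : ∀ w u, extendWindow (win w) u =
      if u.length ≤ L then Option.map₂ Prod.mk (φ (w ++ u)) (κ (w ++ u)) else none := by
    intro w u
    simp [extendWindow, win]
  have hsnd : ∀ w, (fun u => (extendWindow (win w) u).map Prod.snd) =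
      truncate L (shiftBy κ w) := by
    intro w
    funext u
    rw [hext]
    by_cases hu : u.length ≤ L
    · simp only [hu, if_true, truncate, shiftBy]
      have := hκ (w ++ u)
      rcases h1 : φ (w ++ u) with _ | m <;> rcases h2 : κ (w ++ u) with _ | b <;> simp_all
    · simp [truncate, hu]
  have hcenter : ∀ w ∈ optionSupport φ, ∃ m b, φ w = some m ∧
      extendWindow (win w) [] = some (m, b) := by
    intro w hw
    obtain ⟨m, hm⟩ := Option.ne_none_iff_exists'.1 hw
    obtain ⟨b, hb⟩ := Option.ne_none_iff_exists'.1 (hsupp ▸ hw : w ∈ optionSupport κ)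
    exact ⟨m, b, hm, by rw [hext]; simp [hm, hb]⟩
  have hne : ∀ w u, extendWindow (win w) u ≠ none → w ++ u ∈ optionSupport φ := by
    intro w u hu h
    rw [hext, h] at hu
    simp at hu
  have hwin : ∀ w ∈ optionSupport φ, W.IsWindow L Γ φ (win w) := by
    intro w hw
    obtain ⟨m, b, hm, hb⟩ := hcenter w hw
    refine ⟨⟨m, b, hb, w, hm⟩, fun s u hu => ⟨b, ?_⟩, ?_⟩
    · have h1 : (w ++ [s]) ++ u ∈ optionSupport φ := by simpa using hne w _ hu
      have h2 := hφ.1.apply_append_singleton_ne_none.1 (hφ.1.mem_of_append h1)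
      rw [hm] at h2
      cases h2
      exact hb
    · rw [hsnd]
      exact hall w hw
  have hinv' : ∀ u v, Γ.SameVertex φ u v → ∀ z,
      φ (u ++ z) = φ (v ++ z) ∧ κ (u ++ z) = κ (v ++ z) ∧
        (u ++ z ∈ optionSupport φ → c (u ++ z) = c (v ++ z)) := by
    intro u v huv z
    have h1 := huv.apply_append hc hφ z
    refine ⟨h1, ?_, fun hz => (hinv _ _ (huv.append hc hφ hz)).2⟩
    by_cases hz : u ++ z ∈ optionSupport φ
    · exact (hinv _ _ (huv.append hc hφ hz)).1
    · have hz' : φ (u ++ z) = none := not_not.1 hz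
      rw [(hκ _).2 hz', (hκ _).2 (h1 ▸ hz')]
  -- Slots that point outside the support get the dummy colour 0. It is a legal colour because the
  -- alphabet is nonempty as soon as a colour occurs.
  refine ⟨fun w => if hw : w ∈ optionSupport φ then some ⟨win w, hwin w hw⟩ else none,
    fun w t => if w ++ t.1.1 ∈ optionSupport φ then c (w ++ t.1.1) t.2 else 0, ?_, ?_, ?_, ?_, ?_⟩
  · ext w
    change (dite _ _ _ ≠ none) ↔ _
    split_ifs with hw <;> simp [hw]
  · intro u hu v hv huv
    have := hinv' u v ⟨hu, hv, huv⟩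
    constructor
    · simp only [hu, hv, dif_pos, Option.some.injEq, Subtype.mk.injEq]
      funext z
      simp only [win, (this z.1).1, (this z.1).2.1]
    · funext t
      by_cases ht : u ++ t.1.1 ∈ optionSupport φ
      · have ht' : v ++ t.1.1 ∈ optionSupport φ := by
          have := (this t.1.1).1
          exact fun h => ht (this.trans h)
        simp only [ht, ht', if_true, (this t.1.1).2.2 ht]
      · have ht' : v ++ t.1.1 ∉ optionSupport φ := by
          have := (this t.1.1).1
          exact fun h => ht (fun h' => h (this.symm.trans h'))
        simp only [ht, ht', if_false]
  · intro w hw t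
    dsimp only
    split_ifs with h
    · exact hlt _ h _
    · exact (Nat.zero_le _).trans_lt (hlt w hw t.2)
  · intro w a ha r hr i j
    obtain ⟨⟨i₁, hi₁⟩, i₂⟩ := i
    obtain ⟨⟨j₁, hj₁⟩, j₂⟩ := j
    by_cases hw : w ∈ optionSupport φ
    · simp only [hw, dif_pos, Option.some.injEq] at ha
      subst ha
      rintro ⟨⟨h0, h1, h2⟩, h3, h4⟩
      dsimp only at h0 h1 h2 h3 h4
      subst h0
      have hj := hne w _ h1
      rw [hsnd] at h2
      simp only [List.append_nil, hw, hj, if_true] at h3 h4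
      refine hedge w hw _ _ _ _ _ _ hj₁ hj h2 ?_
      rw [h3, h4]
      exact hr
    · simp [hw] at ha
  · intro w s m a a' hm ha ha'
    by_cases hw : w ∈ optionSupport φ
    swap
    · simp [hw] at ha
    by_cases hws : w ++ [s] ∈ optionSupport φ
    swap
    · simp [hws] at ha'
    simp only [hw, hws, dif_pos, Option.some.injEq] at ha ha'
    subst ha ha'
    refine ⟨⟨?_, ?_⟩, ?_⟩
    · obtain ⟨m', b, hm', hb⟩ := hcenter w hw
      rw [hm] at hm'
      cases hm'
      exact ⟨b, hb⟩
    · intro u hu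
      rw [hext, hext]
      simp [hu.le, Nat.succ_le_of_lt hu]
    · rintro ⟨⟨i₁, hi₁⟩, i₂⟩ ⟨⟨j₁, hj₁⟩, j₂⟩ ⟨h1, h2⟩
      dsimp only at h1 h2
      subst h1 h2
      simp

theorem exists_computable [Primcodable M₁] [Primcodable S₁]
    [Primcodable M₂] [Primcodable S₂] [Finite M₁] [Finite S₁] [Finite M₂] [Finite S₂]
    [Finite B] [Finite J] (W : WindowRules M₁ S₁ S₂ B J) (L : ℕ) (hc : Γ.Coherent)
    (hs : Γ.StronglyConnected) (hφ : φ ∈ Γ.modelSpace) :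
    ∃ g : DominoInstance M₁ S₁ → DominoInstance M₂ S₂, Computable g ∧
      ∀ I, Γ.ModelDominoProblem φ (g I) ↔ ∃ κ c, W.Realizes L Γ φ I κ c := by
  obtain ⟨g, hg, h⟩ := (W.slotRules L Γ φ).exists_computable Γ φ
  refine ⟨g, hg, fun I => (h I).trans ⟨?_, ?_⟩⟩
  · rintro ⟨k, c, hk⟩
    exact ⟨_, _, realizes_of_slotRules hc hs hφ hk⟩
  · rintro ⟨κ, c, hk⟩
    exact exists_slotRules_realizes hc hφ hk

end WindowRules

/-! ### Arrays of items with pointers. -/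

/-- A cell lists items, indexed by `J`: each item has a state in `M₁`, and for every generator in
`S₁` a pointer: a displacement of length at most `r` and an index. -/
abbrev Cell (M₁ S₁ S₂ J : Type*) (r : ℕ) : Type _ := J → Option (M₁ × (S₁ → ShortWord S₂ r × J))

namespace Cell

variable {M₁ S₁ M₂ S₂ J : Type*} {r : ℕ}

/-- The item at a position. -/
def item (κ : List S₂ → Option (Cell M₁ S₁ S₂ J r)) (p : List S₂ × J) :
    Option (M₁ × (S₁ → ShortWord S₂ r × J)) :=
  (κ p.1).bind fun f => f p.2

/-- The state of the item at a position. -/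
def stateAt (κ : List S₂ → Option (Cell M₁ S₁ S₂ J r)) (p : List S₂ × J) : Option M₁ :=
  (item κ p).map Prod.fst

open Classical in
/-- The position reached by following the pointer for `s`. -/
noncomputable def move (Γ₁ : Blueprint M₁ S₁) (κ : List S₂ → Option (Cell M₁ S₁ S₂ J r))
    (p : List S₂ × J) (s : S₁) : Option (List S₂ × J) :=
  (item κ p).bind fun t =>
    if t.1 = Γ₁.init s then some (p.1 ++ (t.2 s).1.1, (t.2 s).2) else none

/-- The position reached by following the pointers for the letters of a word. -/
noncomputable def trace (Γ₁ : Blueprint M₁ S₁) (κ : List S₂ → Option (Cell M₁ S₁ S₂ J r)) :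
    List S₂ × J → List S₁ → Option (List S₂ × J)
  | p, [] => some p
  | p, s :: v => (move Γ₁ κ p s).bind fun q => trace Γ₁ κ q v

variable {Γ₁ : Blueprint M₁ S₁} {Γ₂ : Blueprint M₂ S₂}
  {κ : List S₂ → Option (Cell M₁ S₁ S₂ J r)}

theorem trace_append (p : List S₂ × J) (u v : List S₁) :
    trace Γ₁ κ p (u ++ v) = (trace Γ₁ κ p u).bind fun q => trace Γ₁ κ q v := by
  induction u generalizing p with
  | nil => rfl
  | cons s u ih =>
    simp only [List.cons_append, trace, Option.bind_assoc, ih]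

theorem trace_singleton (p : List S₂ × J) (s : S₁) : trace Γ₁ κ p [s] = move Γ₁ κ p s := by
  simp [trace]

theorem move_eq_some {p q : List S₂ × J} {s : S₁} :
    move Γ₁ κ p s = some q ↔ ∃ t, item κ p = some t ∧ t.1 = Γ₁.init s ∧
      q = (p.1 ++ (t.2 s).1.1, (t.2 s).2) := by
  simp only [move, Option.bind_eq_some_iff]
  refine exists_congr fun t => and_congr_right fun _ => ?_
  split_ifs with h
  · simp [h, eq_comm]
  · simp [h]

theorem exists_move_iff {p : List S₂ × J} {s : S₁} :
    (∃ q, move Γ₁ κ p s = some q) ↔ stateAt κ p = some (Γ₁.init s) := by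
  simp only [move_eq_some, stateAt, Option.map_eq_some_iff]
  constructor
  · rintro ⟨q, t, h1, h2, -⟩
    exact ⟨t, h1, h2⟩
  · rintro ⟨t, h1, h2⟩
    exact ⟨_, t, h1, h2, rfl⟩

theorem exists_of_move {p q : List S₂ × J} {s : S₁} (h : move Γ₁ κ p s = some q) :
    ∃ u : List S₂, u.length ≤ r ∧ q.1 = p.1 ++ u := by
  obtain ⟨t, -, -, rfl⟩ := move_eq_some.1 h
  exact ⟨_, (t.2 s).1.2, rfl⟩

theorem item_shiftBy (w u : List S₂) (j : J) : item (shiftBy κ w) (u, j) = item κ (w ++ u, j) := rfl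

theorem stateAt_shiftBy (w u : List S₂) (j : J) :
    stateAt (shiftBy κ w) (u, j) = stateAt κ (w ++ u, j) := rfl

theorem item_truncate {L : ℕ} {p : List S₂ × J} (h : p.1.length ≤ L) :
    item (truncate L κ) p = item κ p := by
  simp [item, truncate, h]

theorem stateAt_truncate {L : ℕ} {p : List S₂ × J} (h : p.1.length ≤ L) :
    stateAt (truncate L κ) p = stateAt κ p := by
  rw [stateAt, item_truncate h, stateAt]

theorem move_truncate {L : ℕ} {p : List S₂ × J} (h : p.1.length ≤ L) (s : S₁) :
    move Γ₁ (truncate L κ) p s = move Γ₁ κ p s := by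
  rw [move, item_truncate h, move]

/-- Each pointer adds at most `r` letters to the position, so a short trace never leaves the window.
-/
theorem trace_truncate {L : ℕ} (v : List S₁) :
    ∀ {p : List S₂ × J}, p.1.length + r * v.length ≤ L →
      trace Γ₁ (truncate L κ) p v = trace Γ₁ κ p v := by
  induction v with
  | nil => intro p _; rfl
  | cons s v ih =>
    intro p hp
    rw [trace, trace, move_truncate (by omega)]
    rcases hq : move Γ₁ κ p s with _ | q
    · rfl
    · obtain ⟨u, hu, hqu⟩ := exists_of_move hq
      refine ih ?_
      rw [hqu, List.length_append]
      rw [List.length_cons, Nat.mul_succ] at hp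
      omega

theorem item_of_truncate {L : ℕ} {p : List S₂ × J} {t} (h : item (truncate L κ) p = some t) :
    item κ p = some t := by
  by_cases hp : p.1.length ≤ L
  · rwa [item_truncate hp] at h
  · simp [item, truncate, hp] at h

theorem move_of_truncate {L : ℕ} {p q : List S₂ × J} {s : S₁}
    (h : move Γ₁ (truncate L κ) p s = some q) : move Γ₁ κ p s = some q := by
  rw [move_eq_some] at h ⊢
  obtain ⟨t, h1, h2⟩ := h
  exact ⟨t, item_of_truncate h1, h2⟩

theorem trace_of_truncate {L : ℕ} {v : List S₁} :
    ∀ {p q : List S₂ × J}, trace Γ₁ (truncate L κ) p v = some q → trace Γ₁ κ p v = some q := by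
  induction v with
  | nil => exact id
  | cons s v ih =>
    intro p q h
    rw [trace, Option.bind_eq_some_iff] at h ⊢
    obtain ⟨z, h1, h2⟩ := h
    exact ⟨z, move_of_truncate h1, ih h2⟩

theorem move_shiftBy (w : List S₂) (p : List S₂ × J) (s : S₁) :
    move Γ₁ κ (w ++ p.1, p.2) s =
      (move Γ₁ (shiftBy κ w) p s).map fun q => (w ++ q.1, q.2) := by
  obtain ⟨u, j⟩ := p
  rw [move, move, item_shiftBy]
  rcases item κ (w ++ u, j) with _ | t
  · rfl
  · simp only [Option.bind_some]
    split_ifs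
    · simp
    · rfl

theorem trace_shiftBy (w : List S₂) (v : List S₁) : ∀ p : List S₂ × J,
    trace Γ₁ κ (w ++ p.1, p.2) v =
      (trace Γ₁ (shiftBy κ w) p v).map fun q => (w ++ q.1, q.2) := by
  induction v with
  | nil => intro p; rfl
  | cons s v ih =>
    intro p
    rw [trace, trace, move_shiftBy]
    rcases move Γ₁ (shiftBy κ w) p s with _ | q
    · rfl
    · exact ih q

/-- The rules for arrays of cells which describe a model of `Γ₁` on a model of `Γ₂`. -/
noncomputable def rules (Γ₁ : Blueprint M₁ S₁) (Γ₂ : Blueprint M₂ S₂) (J : Type*) (r : ℕ) :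
    WindowRules M₁ S₁ S₂ (Cell M₁ S₁ S₂ J r) J where
  allowed := {κ | (∃ p, stateAt κ p ≠ none) ∧
    (∀ i s q, move Γ₁ κ ([], i) s = some q → ∃ m ∈ Γ₁.term s, stateAt κ q = some m) ∧
    ∀ ρ ∈ Γ₁.rels, ∀ i q q', stateAt κ ([], i) ≠ none → trace Γ₁ κ ([], i) ρ.1 = some q →
      trace Γ₁ κ ([], i) ρ.2 = some q' → Γ₂.Equivalent q.1 q'.1 ∧ q.2 = q'.2}
  edge κ s m i m' u j :=
    stateAt κ ([], i) = some m ∧ move Γ₁ κ ([], i) s = some (u, j) ∧ stateAt κ (u, j) = some m'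

/-! ### Soundness: arrays that obey the rules yield coloured models of `Γ₁`. -/

section Decode

variable {φ₂ : List S₂ → Option M₂} {I : DominoInstance M₁ S₁} {L : ℕ} {c : List S₂ → J → ℕ}

theorem mem_of_stateAt (h : optionSupport κ = optionSupport φ₂) {p : List S₂ × J}
    (hp : stateAt κ p ≠ none) : p.1 ∈ optionSupport φ₂ := by
  rw [← h]
  intro hcon
  simp [stateAt, item, hcon] at hp

theorem stateAt_move (h : (rules Γ₁ Γ₂ J r).Realizes L Γ₂ φ₂ I κ c) (hr : r ≤ L)
    {p q : List S₂ × J} {s : S₁} (hq : move Γ₁ κ p s = some q) :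
    ∃ m ∈ Γ₁.term s, stateAt κ q = some m := by
  have hp : p.1 ∈ optionSupport φ₂ := mem_of_stateAt h.1 (by
    rw [exists_move_iff.1 ⟨q, hq⟩]; simp)
  have hall := (h.2.2.2.1 p.1 hp).2.1
  have hm := move_shiftBy (Γ₁ := Γ₁) (κ := κ) p.1 ([], p.2) s
  simp only [List.append_nil] at hm
  rw [hq] at hm
  obtain ⟨z, hz, rfl⟩ := Option.map_eq_some_iff.1 hm.symm
  rw [← move_truncate (L := L) (by simp)] at hz
  obtain ⟨m, hm1, hm2⟩ := hall p.2 s z hz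
  obtain ⟨u, hu, hzu⟩ := exists_of_move hz
  have hzL : z.1.length ≤ L := by rw [hzu]; simpa using hu.trans hr
  rw [stateAt_truncate hzL] at hm2
  exact ⟨m, hm1, hm2⟩

/-- Two positions with the same index, at words for the same vertex. -/
def SamePosition (Γ₂ : Blueprint M₂ S₂) (φ₂ : List S₂ → Option M₂) (p q : List S₂ × J) : Prop :=
  Γ₂.SameVertex φ₂ p.1 q.1 ∧ p.2 = q.2

theorem item_eq_of_samePosition (h : (rules Γ₁ Γ₂ J r).Realizes L Γ₂ φ₂ I κ c)
    {p p' : List S₂ × J} (hp : SamePosition Γ₂ φ₂ p p') : item κ p = item κ p' := by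
  rw [item, item, (h.2.1 _ _ hp.1).1, hp.2]

/-- Items and pointers depend only on the vertex, and equal displacements from equivalent words stay
equivalent. -/
theorem trace_of_samePosition (hc₂ : Γ₂.Coherent) (hφ₂ : φ₂ ∈ Γ₂.modelSpace)
    (h : (rules Γ₁ Γ₂ J r).Realizes L Γ₂ φ₂ I κ c) (hr : r ≤ L) (v : List S₁) :
    ∀ {p p' q : List S₂ × J}, SamePosition Γ₂ φ₂ p p' → trace Γ₁ κ p v = some q →
      ∃ q', trace Γ₁ κ p' v = some q' ∧ SamePosition Γ₂ φ₂ q q' := by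
  induction v with
  | nil =>
    rintro p p' q hp hq
    cases hq
    exact ⟨p', rfl, hp⟩
  | cons s v ih =>
    intro p p' q hp hq
    rw [trace, Option.bind_eq_some_iff] at hq
    obtain ⟨z, hz, hq⟩ := hq
    have hmem : z.1 ∈ optionSupport φ₂ := by
      obtain ⟨m, -, hm⟩ := stateAt_move h hr hz
      exact mem_of_stateAt h.1 (by simp [hm])
    obtain ⟨t, h1, h2, rfl⟩ := move_eq_some.1 hz
    rw [item_eq_of_samePosition h hp] at h1
    obtain ⟨q', h3, h4⟩ := ih (p := (p.1 ++ (t.2 s).1.1, (t.2 s).2))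
      (p' := (p'.1 ++ (t.2 s).1.1, (t.2 s).2))
      ⟨hp.1.append hc₂ hφ₂ hmem, rfl⟩ hq
    refine ⟨q', ?_, h4⟩
    rw [trace, move_eq_some.2 ⟨t, h1, h2, rfl⟩]
    exact h3

theorem stateAt_trace (h : (rules Γ₁ Γ₂ J r).Realizes L Γ₂ φ₂ I κ c) (hr : r ≤ L) (v : List S₁) :
    ∀ {p q : List S₂ × J}, stateAt κ p ≠ none → trace Γ₁ κ p v = some q → stateAt κ q ≠ none := by
  induction v with
  | nil =>
    rintro p q hp hq
    cases hq
    exact hp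
  | cons s v ih =>
    intro p q hp hq
    rw [trace, Option.bind_eq_some_iff] at hq
    obtain ⟨z, hz, hq⟩ := hq
    obtain ⟨m, -, hm⟩ := stateAt_move h hr hz
    exact ih (by simp [hm]) hq

/-- The map `S₁* → M₁ ∪ {∅}` which reads the states along traces. -/
noncomputable def decode (Γ₁ : Blueprint M₁ S₁) (κ : List S₂ → Option (Cell M₁ S₁ S₂ J r))
    (p : List S₂ × J) (v : List S₁) : Option M₁ :=
  (trace Γ₁ κ p v).bind (stateAt κ)

theorem decode_append_singleton (p : List S₂ × J) (v : List S₁) (s : S₁) :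
    decode Γ₁ κ p (v ++ [s]) =
      (trace Γ₁ κ p v).bind fun q => (move Γ₁ κ q s).bind (stateAt κ) := by
  simp only [decode, trace_append, trace_singleton, Option.bind_assoc]

theorem consistentMap_decode (h : (rules Γ₁ Γ₂ J r).Realizes L Γ₂ φ₂ I κ c) (hr : r ≤ L)
    {p : List S₂ × J} (hp : stateAt κ p ≠ none) : Γ₁.ConsistentMap (decode Γ₁ κ p) := by
  refine ⟨hp, fun v s => ⟨fun hv => ?_, fun hv => ?_⟩⟩
  · obtain ⟨q, hq, hqs⟩ := Option.bind_eq_some_iff.1 hv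
    obtain ⟨z, hz⟩ := exists_move_iff.2 hqs
    obtain ⟨m, hm, hzm⟩ := stateAt_move h hr hz
    refine ⟨m, hm, ?_⟩
    rw [decode_append_singleton, hq]
    simp [hz, hzm]
  · rw [decode_append_singleton]
    rcases hq : trace Γ₁ κ p v with _ | q
    · rfl
    · simp only [Option.bind_some]
      rcases hz : move Γ₁ κ q s with _ | z
      · rfl
      · refine absurd ?_ hv
        rw [decode, hq]
        exact exists_move_iff.1 ⟨z, hz⟩

/-- The common prefix leads to one item; the rule for relations, applied in the window centered
there, merges the two branches; the common suffix keeps them merged. The bound on `L` keeps both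
sides of the relation inside the window. -/
theorem samePosition_of_similar (hc₂ : Γ₂.Coherent) (hφ₂ : φ₂ ∈ Γ₂.modelSpace)
    (h : (rules Γ₁ Γ₂ J r).Realizes L Γ₂ φ₂ I κ c) (hr : r ≤ L)
    (hL : ∀ ρ ∈ Γ₁.rels, r * ρ.1.length ≤ L ∧ r * ρ.2.length ≤ L)
    {p : List S₂ × J} (hp : stateAt κ p ≠ none) {u v : List S₁} (huv : Γ₁.Similar u v)
    {q q' : List S₂ × J} (hq : trace Γ₁ κ p u = some q) (hq' : trace Γ₁ κ p v = some q') :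
    SamePosition Γ₂ φ₂ q q' := by
  obtain ⟨-, -, ρ, hρ, x, y, rfl, rfl⟩ := huv
  simp only [trace_append, Option.bind_eq_some_iff] at hq hq'
  obtain ⟨b, ⟨a, ha, hab⟩, hbq⟩ := hq
  obtain ⟨b', ⟨a', ha', hab'⟩, hbq'⟩ := hq'
  rw [ha] at ha'
  cases ha'
  have hsa := stateAt_trace h hr x hp ha
  have hmema := mem_of_stateAt h.1 hsa
  have hmemb := mem_of_stateAt h.1 (stateAt_trace h hr _ hsa hab)
  have hmemb' := mem_of_stateAt h.1 (stateAt_trace h hr _ hsa hab')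
  have key : SamePosition Γ₂ φ₂ b b' := by
    have h1 := trace_shiftBy (Γ₁ := Γ₁) (κ := κ) a.1 ρ.1 ([], a.2)
    have h2 := trace_shiftBy (Γ₁ := Γ₁) (κ := κ) a.1 ρ.2 ([], a.2)
    simp only [List.append_nil] at h1 h2
    rw [hab] at h1
    rw [hab'] at h2
    obtain ⟨z, hz, rfl⟩ := Option.map_eq_some_iff.1 h1.symm
    obtain ⟨z', hz', rfl⟩ := Option.map_eq_some_iff.1 h2.symm
    rw [← trace_truncate (L := L) _ (by simpa using (hL ρ hρ).1)] at hz
    rw [← trace_truncate (L := L) _ (by simpa using (hL ρ hρ).2)] at hz'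
    obtain ⟨h3, h4⟩ := (h.2.2.2.1 a.1 hmema).2.2 ρ hρ a.2 z z' (by
      rw [stateAt_truncate (by simp), stateAt_shiftBy, List.append_nil]; exact hsa) hz hz'
    exact ⟨Blueprint.SameVertex.prepend hc₂ hφ₂ hmema ⟨hmemb, hmemb', h3⟩, h4⟩
  obtain ⟨z, hz, hqz⟩ := trace_of_samePosition hc₂ hφ₂ h hr y key hbq
  rw [hbq'] at hz
  cases hz
  exact hqz

theorem dominoProblem_of_realizes (hc₁ : Γ₁.Coherent) (hc₂ : Γ₂.Coherent)
    (hφ₂ : φ₂ ∈ Γ₂.modelSpace) (h : (rules Γ₁ Γ₂ J r).Realizes L Γ₂ φ₂ I κ c) (hr : r ≤ L)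
    (hL : ∀ ρ ∈ Γ₁.rels, r * ρ.1.length ≤ L ∧ r * ρ.2.length ≤ L) : Γ₁.DominoProblem I := by
  classical
  obtain ⟨p, hp⟩ : ∃ p, stateAt κ p ≠ none := by
    obtain ⟨p, hp⟩ := (h.2.2.2.1 [] hφ₂.1.1).1
    refine ⟨p, fun hcon => hp ?_⟩
    rcases ht : item (truncate L (shiftBy κ [])) p with _ | t
    · rw [stateAt, ht]; rfl
    · have := item_of_truncate ht
      rw [item_shiftBy] at this
      simp only [List.nil_append] at this
      simp [stateAt, this] at hcon
  have hcm := consistentMap_decode h hr hp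
  have htr : ∀ v, v ∈ optionSupport (decode Γ₁ κ p) ↔ ∃ q, trace Γ₁ κ p v = some q := by
    intro v
    refine Option.ne_none_iff_exists'.trans ⟨?_, ?_⟩
    · rintro ⟨m, hm⟩
      obtain ⟨q, hq, -⟩ := Option.bind_eq_some_iff.1 hm
      exact ⟨q, hq⟩
    · rintro ⟨q, hq⟩
      obtain ⟨m, hm⟩ := Option.ne_none_iff_exists'.1 (stateAt_trace h hr v hp hq)
      exact ⟨m, by rw [decode, hq]; exact hm⟩
  have hstate : ∀ {q q'}, SamePosition Γ₂ φ₂ q q' → stateAt κ q = stateAt κ q' := fun hqq => by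
    rw [stateAt, stateAt, item_eq_of_samePosition h hqq]
  have hmod : decode Γ₁ κ p ∈ Γ₁.modelSpace := by
    -- Coherence of `Γ₁` enters here: the decoded map needs to be tested only at similar words,
    -- which is what the local rules control.
    refine hc₁.mem_modelSpace hcm fun u hu v hv huv => ?_
    obtain ⟨q, hq⟩ := (htr u).1 hu
    obtain ⟨q', hq'⟩ := (htr v).1 hv
    rw [decode, decode, hq, hq']
    exact hstate (samePosition_of_similar hc₂ hφ₂ h hr hL hp huv hq hq')
  have hlt : ∀ {v q}, trace Γ₁ κ p v = some q → c q.1 q.2 < I.1 := fun {v q} hq =>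
    h.2.2.1 _ (mem_of_stateAt h.1 (stateAt_trace h hr v hp hq)) _
  let x : List S₁ → Option (Fin I.1) := fun v =>
    (trace Γ₁ κ p v).bind fun q => if hq : c q.1 q.2 < I.1 then some ⟨_, hq⟩ else none
  have hx : ∀ {v q} (hq : trace Γ₁ κ p v = some q), x v = some ⟨c q.1 q.2, hlt hq⟩ := by
    intro v q hq
    simp [x, hq, hlt hq]
  refine ⟨(decode Γ₁ κ p, x), hmod, (mem_modelSubshift_patterns _ _ _ _).2 ⟨?_, ?_, ?_⟩⟩
  · ext v
    rw [htr]
    refine Option.ne_none_iff_exists'.trans ⟨?_, ?_⟩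
    · rintro ⟨a, ha⟩
      obtain ⟨q, hq, -⟩ := Option.bind_eq_some_iff.1 ha
      exact ⟨q, hq⟩
    · rintro ⟨q, hq⟩
      exact ⟨_, hx hq⟩
  · intro u hu v hv huv
    have hch := Blueprint.SameVertex.chain hc₁ hmod ⟨hu, hv, huv⟩
    clear hu hv huv
    induction hch with
    | rel a b hab =>
      obtain ⟨q, hq⟩ := (htr a).1 hab.1
      obtain ⟨q', hq'⟩ := (htr b).1 hab.2.1
      have hqq := samePosition_of_similar hc₂ hφ₂ h hr hL hp hab.2.2 hq hq'
      change x a = x b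
      rw [hx hq, hx hq']
      simp only [Option.some.injEq, Fin.mk.injEq]
      rw [(h.2.1 _ _ hqq.1).2, hqq.2]
    | refl => rfl
    | symm _ _ _ ih => exact ih.symm
    | trans _ _ _ _ _ ih₁ ih₂ => exact ih₁.trans ih₂
  · intro v s m m' a b hm hm' ha hb
    obtain ⟨q, hq, hqm⟩ := Option.bind_eq_some_iff.1 hm
    obtain ⟨z, hz, hzm⟩ := Option.bind_eq_some_iff.1 hm'
    change x v = some a at ha
    change x (v ++ [s]) = some b at hb
    rw [hx hq] at ha
    rw [hx hz] at hb
    cases ha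
    cases hb
    rw [trace_append, hq] at hz
    simp only [Option.bind_some, trace_singleton] at hz
    have hq1 := mem_of_stateAt h.1 (p := q) (by simp [hqm])
    have hz1 := mem_of_stateAt h.1 (p := z) (by simp [hzm])
    have h1 := move_shiftBy (Γ₁ := Γ₁) (κ := κ) q.1 ([], q.2) s
    simp only [List.append_nil] at h1
    rw [hz] at h1
    obtain ⟨y, hy, rfl⟩ := Option.map_eq_some_iff.1 h1.symm
    rw [← move_truncate (L := L) (by simp)] at hy
    obtain ⟨u, hu, hyu⟩ := exists_of_move hy
    have hyL : y.1.length ≤ L := by rw [hyu]; simpa using hu.trans hr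
    refine h.2.2.2.2 q.1 hq1 s m q.2 m' y.1 y.2 hyL hz1 ⟨?_, hy, ?_⟩
    · rw [stateAt_truncate (by simp), stateAt_shiftBy, List.append_nil]
      exact hqm
    · rw [stateAt_truncate (by simpa using hyL), stateAt_shiftBy]
      exact hzm

end Decode

end Cell

/-! ### Completeness: drawing `φ₁` on `φ₂` along a coding. -/

/-- A coding of the vertices of a model `φ₁` by pairs of a vertex of a model `φ₂` and an index,
given on words. -/
structure VertexCoding {M₁ S₁ M₂ S₂ : Type*} (Γ₁ : Blueprint M₁ S₁) (Γ₂ : Blueprint M₂ S₂)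
    (φ₁ : List S₁ → Option M₁) (φ₂ : List S₂ → Option M₂) (J : Type*) (r d : ℕ) where
  place : List S₁ → List S₂
  index : List S₁ → J
  congr : ∀ u v, Γ₁.SameVertex φ₁ u v → place u = place v ∧ index u = index v
  place_mem : ∀ u ∈ optionSupport φ₁, place u ∈ optionSupport φ₂
  injective : ∀ u ∈ optionSupport φ₁, ∀ v ∈ optionSupport φ₁,
    Γ₂.SameVertex φ₂ (place u) (place v) → index u = index v → Γ₁.SameVertex φ₁ u v
  near : ∀ u s, φ₁ u = some (Γ₁.init s) →
    ∃ z : List S₂, z.length ≤ r ∧ Γ₂.SameVertex φ₂ (place u ++ z) (place (u ++ [s]))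
  dense : ∀ w ∈ optionSupport φ₂, ∃ z : List S₂, z.length ≤ d ∧ ∃ u ∈ optionSupport φ₁,
    Γ₂.SameVertex φ₂ (w ++ z) (place u)

namespace VertexCoding

open Cell

variable {M₁ S₁ M₂ S₂ J : Type*} {Γ₁ : Blueprint M₁ S₁} {Γ₂ : Blueprint M₂ S₂}
  {φ₁ : List S₁ → Option M₁} {φ₂ : List S₂ → Option M₂} {r d : ℕ}
  (V : VertexCoding Γ₁ Γ₂ φ₁ φ₂ J r d)

/-- The position `p` codes the vertex of the word `u`. -/
def Codes (p : List S₂ × J) (u : List S₁) : Prop :=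
  u ∈ optionSupport φ₁ ∧ Γ₂.SameVertex φ₂ p.1 (V.place u) ∧ V.index u = p.2

theorem exists_pointer (u : List S₁) (s : S₁) : ∃ q : ShortWord S₂ r × J,
    φ₁ u = some (Γ₁.init s) → Γ₂.SameVertex φ₂ (V.place u ++ q.1.1) (V.place (u ++ [s])) ∧
      V.index (u ++ [s]) = q.2 := by
  by_cases h : φ₁ u = some (Γ₁.init s)
  · obtain ⟨z, hz, hzs⟩ := V.near u s h
    exact ⟨(⟨z, hz⟩, V.index (u ++ [s])), fun _ => ⟨hzs, rfl⟩⟩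
  · exact ⟨(⟨[], by simp⟩, V.index u), fun h' => absurd h' h⟩

/-- The pointer from a vertex along a generator. -/
noncomputable def pointer (u : List S₁) (s : S₁) : ShortWord S₂ r × J :=
  (V.exists_pointer u s).choose

open Classical in
/-- The array of cells which describes `φ₁` on `φ₂`. -/
noncomputable def cells (w : List S₂) : Option (Cell M₁ S₁ S₂ J r) :=
  if w ∈ optionSupport φ₂ then
    some fun j => if h : ∃ u, V.Codes (w, j) u then
      (φ₁ h.choose).map fun m => (m, V.pointer h.choose) else none
  else none

open Classical in
/-- The transported colouring. -/
noncomputable def colours {n : ℕ} (y : List S₁ → Option (Fin n)) (w : List S₂) (j : J) : ℕ :=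
  if h : ∃ u, V.Codes (w, j) u then (y h.choose).elim 0 Fin.val else 0

variable {V}

theorem Codes.sameVertex {p : List S₂ × J} {u v : List S₁} (hu : V.Codes p u) (hv : V.Codes p v) :
    Γ₁.SameVertex φ₁ u v :=
  V.injective u hu.1 v hv.1 (hu.2.1.symm.trans hv.2.1) (hu.2.2.trans hv.2.2.symm)

/-- The item stores the pointers of a chosen word `v` for the coded vertex, which may differ from
`u`; injectivity of the coding makes the two words equivalent. -/
theorem Codes.item_cells (h₁ : φ₁ ∈ Γ₁.modelSpace) {p : List S₂ × J} {u : List S₁}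
    (hu : V.Codes p u) : ∃ v m, V.Codes p v ∧ φ₁ u = some m ∧
      item V.cells p = some (m, V.pointer v) := by
  classical
  have h : ∃ v, V.Codes (p.1, p.2) v := ⟨u, hu⟩
  have hv : V.Codes p h.choose := h.choose_spec
  obtain ⟨m, hm⟩ := Option.ne_none_iff_exists'.1 hv.1
  refine ⟨h.choose, m, hv, ?_, ?_⟩
  · rw [← hm]
    exact (hu.sameVertex hv).eq h₁
  · rw [item, cells, if_pos hu.2.1.1, Option.bind_some]
    refine (dif_pos h).trans ?_
    rw [hm]
    rfl

theorem exists_codes {p : List S₂ × J} (h : stateAt V.cells p ≠ none) : ∃ u, V.Codes p u := by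
  classical
  by_contra hcon
  refine h ?_
  rw [stateAt, item, cells]
  split_ifs with hw
  · rw [Option.bind_some]
    exact congrArg _ (dif_neg hcon)
  · rfl

theorem Codes.stateAt_cells (h₁ : φ₁ ∈ Γ₁.modelSpace) {p : List S₂ × J} {u : List S₁}
    (hu : V.Codes p u) : stateAt V.cells p = φ₁ u := by
  obtain ⟨v, m, -, hm, hi⟩ := hu.item_cells h₁
  rw [stateAt, hi, hm]
  rfl

theorem Codes.move_cells (hc₁ : Γ₁.Coherent) (h₁ : φ₁ ∈ Γ₁.modelSpace) (hc₂ : Γ₂.Coherent)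
    (h₂ : φ₂ ∈ Γ₂.modelSpace) {p q : List S₂ × J} {u : List S₁} {s : S₁}
    (hu : V.Codes p u) (hq : move Γ₁ V.cells p s = some q) :
    φ₁ u = some (Γ₁.init s) ∧ V.Codes q (u ++ [s]) := by
  have hs : φ₁ u = some (Γ₁.init s) := by
    rw [← hu.stateAt_cells h₁]
    exact exists_move_iff.1 ⟨q, hq⟩
  refine ⟨hs, ?_⟩
  obtain ⟨v, m, hv, hm, hi⟩ := hu.item_cells h₁
  obtain ⟨t, ht, -, rfl⟩ := move_eq_some.1 hq
  rw [hi] at ht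
  cases ht
  have huv := hu.sameVertex hv
  have hvs : φ₁ v = some (Γ₁.init s) := by rw [← huv.eq h₁, hs]
  obtain ⟨h3, h4⟩ := (V.exists_pointer v s).choose_spec hvs
  have hus := h₁.1.apply_append_singleton_ne_none.2 hs
  obtain ⟨h5, h6⟩ := V.congr _ _ (huv.append hc₁ h₁ hus)
  refine ⟨hus, ?_, ?_⟩
  · rw [h5]
    exact (hv.2.1.symm.append hc₂ h₂ h3.1).symm.trans h3
  · rw [h6]
    exact h4

theorem Codes.trace_cells (hc₁ : Γ₁.Coherent) (h₁ : φ₁ ∈ Γ₁.modelSpace) (hc₂ : Γ₂.Coherent)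
    (h₂ : φ₂ ∈ Γ₂.modelSpace) {q : List S₂ × J} {v : List S₁} :
    ∀ {p : List S₂ × J} {u : List S₁}, V.Codes p u → trace Γ₁ V.cells p v = some q →
      V.Codes q (u ++ v) := by
  induction v with
  | nil =>
    rintro p u hu hq
    cases hq
    simpa using hu
  | cons s v ih =>
    intro p u hu hq
    rw [trace, Option.bind_eq_some_iff] at hq
    obtain ⟨z, hz, hq⟩ := hq
    simpa using ih (hu.move_cells hc₁ h₁ hc₂ h₂ hz).2 hq

theorem Codes.colours_eq {n : ℕ} {y : List S₁ → Option (Fin n)}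
    (hy : ∀ u ∈ optionSupport φ₁, ∀ v ∈ optionSupport φ₁, Γ₁.Equivalent u v → y u = y v)
    {w : List S₂} {j : J} {u : List S₁} (hu : V.Codes (w, j) u) {a : Fin n} (ha : y u = some a) :
    V.colours y w j = a := by
  classical
  have h : ∃ v, V.Codes (w, j) v := ⟨u, hu⟩
  obtain ⟨h1, h2, h3⟩ := hu.sameVertex h.choose_spec
  rw [colours, dif_pos h, ← hy u h1 _ h2 h3, ha]
  rfl

/-- Equality of predicates, rather than a pointwise equivalence, makes the words picked by `choose`
at `u` and `v` literally the same. Hence cells and colours agree at equivalent words. -/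
theorem codes_congr {u v : List S₂} (huv : Γ₂.SameVertex φ₂ u v) (j : J) :
    V.Codes (u, j) = V.Codes (v, j) := by
  funext w
  exact propext ⟨fun h => ⟨h.1, huv.symm.trans h.2.1, h.2.2⟩,
    fun h => ⟨h.1, huv.trans h.2.1, h.2.2⟩⟩

/-- Traces from an item that codes `u` reach items that code `u ++ v`, so each rule becomes a
property of `φ₁` or of its configuration `y`. Density of the coding makes an item visible in every
window. -/
theorem realizes_cells (hc₁ : Γ₁.Coherent) (h₁ : φ₁ ∈ Γ₁.modelSpace) (hc₂ : Γ₂.Coherent)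
    (hs₂ : Γ₂.StronglyConnected) (h₂ : φ₂ ∈ Γ₂.modelSpace) {L : ℕ} (hr : r ≤ L) (hd : d ≤ L)
    {I : DominoInstance M₁ S₁} {y : List S₁ → Option (Fin I.1)}
    (hy : y ∈ Γ₁.modelSubshift φ₁ (DominoInstance.patterns I)) :
    (rules Γ₁ Γ₂ J r).Realizes L Γ₂ φ₂ I V.cells (V.colours y) := by
  classical
  rw [mem_modelSubshift_patterns] at hy
  obtain ⟨hysupp, hyinv, hypat⟩ := hy
  have hpos : 0 < I.1 := by
    have : ([] : List S₁) ∈ optionSupport y := hysupp ▸ h₁.1.1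
    obtain ⟨a, -⟩ := Option.ne_none_iff_exists'.1 this
    exact a.pos
  have hcode : ∀ {w i s q}, move Γ₁ (truncate L (shiftBy V.cells w)) ([], i) s = some q →
      ∃ u, V.Codes (w, i) u ∧ φ₁ u = some (Γ₁.init s) ∧ V.Codes (w ++ q.1, q.2) (u ++ [s]) := by
    intro w i s q hq
    have h1 := move_shiftBy (Γ₁ := Γ₁) (κ := V.cells) w ([], i) s
    rw [move_of_truncate hq] at h1
    simp only [List.append_nil, Option.map_some] at h1
    obtain ⟨u, hu⟩ := exists_codes (V := V) (p := (w, i)) (by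
      rw [exists_move_iff.1 ⟨_, h1⟩]; simp)
    exact ⟨u, hu, hu.move_cells hc₁ h₁ hc₂ h₂ h1⟩
  refine ⟨?_, ?_, ?_, ?_, ?_⟩
  · ext w
    change (ite _ _ _ ≠ none) ↔ _
    split_ifs with hw <;> simp [hw]
  · intro u v huv
    constructor
    · simp only [cells, huv.1, huv.2.1, if_true]
      simp only [codes_congr huv]
    · funext j
      simp only [colours, codes_congr huv]
  · intro w _ j
    rw [colours]
    split_ifs with h
    · rcases y h.choose with _ | a
      · exact hpos
      · exact a.2
    · exact hpos
  · intro w hw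
    refine ⟨?_, ?_, ?_⟩
    · obtain ⟨z, hz, u, hu, hzu⟩ := V.dense w hw
      refine ⟨(z, V.index u), ?_⟩
      have hcu : V.Codes (w ++ z, V.index u) u := ⟨hu, hzu, rfl⟩
      rw [stateAt_truncate (hz.trans hd), stateAt_shiftBy, hcu.stateAt_cells h₁]
      exact hu
    · intro i s q hq
      obtain ⟨u, -, hu, hus⟩ := hcode hq
      obtain ⟨m, hm, hm'⟩ := (h₁.1.2 u s).1 hu
      refine ⟨m, hm, ?_⟩
      obtain ⟨z, hz, hqz⟩ := exists_of_move hq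
      rw [stateAt_truncate (by rw [hqz]; simpa using hz.trans hr)]
      exact (hus.stateAt_cells h₁).trans hm'
    · intro ρ hρ i q q' hi hq hq'
      have key : ∀ {v q}, trace Γ₁ (truncate L (shiftBy V.cells w)) ([], i) v = some q →
          trace Γ₁ V.cells (w, i) v = some (w ++ q.1, q.2) := by
        intro v q hq
        have h1 := trace_shiftBy (Γ₁ := Γ₁) (κ := V.cells) w v ([], i)
        rw [trace_of_truncate hq] at h1
        simpa using h1
      rw [stateAt_truncate (by simp), stateAt_shiftBy, List.append_nil] at hi
      obtain ⟨u, hu⟩ := exists_codes hi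
      have h3 := hu.trace_cells hc₁ h₁ hc₂ h₂ (key hq)
      have h4 := hu.trace_cells hc₁ h₁ hc₂ h₂ (key hq')
      have hsim : Γ₁.Similar (u ++ ρ.1) (u ++ ρ.2) :=
        ⟨h₁.1.consistentWord h3.1, h₁.1.consistentWord h4.1, ρ, hρ, u, [], by simp, by simp⟩
      obtain ⟨h5, h6⟩ := V.congr _ _ ⟨h3.1, h4.1, .rel _ _ hsim⟩
      have h7 : Γ₂.SameVertex φ₂ (w ++ q.1) (w ++ q'.1) := by
        refine h3.2.1.trans ?_
        rw [h5]
        exact h4.2.1.symm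
      -- The two ends agree as words read from the origin, whereas the rule compares displacements
      -- read from `w`. Left cancellation bridges the gap.
      exact ⟨(h7.cancel hc₂ hs₂ h₂).2.2, by rw [← h3.2.2, ← h4.2.2, h6]⟩
  · intro w hw s m i m' u j hu hwu hE
    obtain ⟨h3, h4, h5⟩ := hE
    obtain ⟨v, hv, hvs, hv'⟩ := hcode h4
    rw [stateAt_truncate (by simp), stateAt_shiftBy, List.append_nil, hv.stateAt_cells h₁] at h3
    rw [stateAt_truncate hu, stateAt_shiftBy, hv'.stateAt_cells h₁] at h5
    obtain ⟨a, ha⟩ := Option.ne_none_iff_exists'.1 (hysupp ▸ hv.1 : v ∈ optionSupport y)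
    obtain ⟨b, hb⟩ := Option.ne_none_iff_exists'.1 (hysupp ▸ hv'.1 : v ++ [s] ∈ optionSupport y)
    rw [hv.colours_eq hyinv ha, hv'.colours_eq hyinv hb]
    exact hypat v s m m' a b h3 h5 ha hb

end VertexCoding

/-! ### Quasi-isometries give codings. -/

theorem directedDist_self {V : Type*} (E : V → V → Prop) (x : V) : directedDist E x x = 0 := by
  have : (0 : ℕ) ∈ {n | HasDirectedPath E n x x} := ⟨fun _ => x, rfl, rfl, by simp⟩
  simp [directedDist, Nat.sInf_eq_zero.2 (Or.inl this)]

theorem directedDist_le_one {V : Type*} {E : V → V → Prop} {x y : V} (h : E x y) :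
    directedDist E x y ≤ 1 := by
  have : (1 : ℕ) ∈ {n | HasDirectedPath E n x y} := by
    refine ⟨fun n => if n = 0 then x else y, by simp, by simp, fun k hk => ?_⟩
    obtain rfl : k = 0 := by omega
    simpa using h
  rw [directedDist]
  exact_mod_cast Nat.sInf_le this

namespace Blueprint

/-- A vertex `x` is determined by `f x` and a short word leading to `x` from a base point of its
fibre. That word serves as the index. -/
theorem exists_vertexCoding {M₁ S₁ M₂ S₂ : Type*} {Γ₁ : Blueprint M₁ S₁} {Γ₂ : Blueprint M₂ S₂}
    {φ₁ : List S₁ → Option M₁} {φ₂ : List S₂ → Option M₂} (hc₁ : Γ₁.Coherent)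
    (hs₁ : Γ₁.StronglyConnected) (h₁ : φ₁ ∈ Γ₁.modelSpace) (hc₂ : Γ₂.Coherent)
    (hs₂ : Γ₂.StronglyConnected) (h₂ : φ₂ ∈ Γ₂.modelSpace)
    {f : Γ₁.vertices φ₁ → Γ₂.vertices φ₂}
    (hf : IsQuasiIsometry (Γ₁.modelDist φ₁) (Γ₂.modelDist φ₂) f) :
    ∃ R r d, Nonempty (VertexCoding Γ₁ Γ₂ φ₁ φ₂ (ShortWord S₁ R) r d) := by
  classical
  obtain ⟨C, D, lam, -, -, hlam, hqi, hdense⟩ := hf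
  have hlam0 : 0 < lam := one_pos.trans_le hlam
  choose rep₁ hrep₁ hrep₁' using fun a : Γ₁.vertices φ₁ => exists_vertexOf a
  choose rep₂ hrep₂ hrep₂' using fun a : Γ₂.vertices φ₂ => exists_vertexOf a
  obtain ⟨base, hbase⟩ : ∃ base : Γ₂.vertices φ₂ → Γ₁.vertices φ₁, ∀ x, f (base (f x)) = f x := by
    refine ⟨fun b => if h : ∃ x, f x = b then h.choose else Γ₁.vertexOf φ₁ [] h₁.1.1, fun x => ?_⟩
    have h : ∃ y, f y = f x := ⟨x, rfl⟩
    simp only [dif_pos h]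
    exact h.choose_spec
  -- Inside a fibre the images have distance 0, so the lower quasi-isometry bound gives distance at
  -- most `lam * C` from the base point.
  have hindex : ∀ x, ∃ z : ShortWord S₁ ⌊lam * C⌋₊,
      ∃ h, x = Γ₁.vertexOf φ₁ (rep₁ (base (f x)) ++ z.1) h := by
    intro x
    have h := (hqi (base (f x)) x).1
    rw [hbase, modelDist, modelDist, directedDist_self] at h
    have h' : Γ₁.modelDist φ₁ (base (f x)) x ≤ lam * C := by
      rw [sub_nonpos, one_div, inv_mul_le_iff₀ hlam0] at h
      exact h
    rw [hrep₁' (base (f x))] at h'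
    obtain ⟨z, hz, hz'⟩ := exists_word_of_dist_le hc₁ hs₁ h₁ _ h'
    exact ⟨⟨z, Nat.le_floor hz⟩, hz'⟩
  choose index hindex hindex' using hindex
  let place : List S₁ → List S₂ := fun u =>
    if hu : u ∈ optionSupport φ₁ then rep₂ (f (Γ₁.vertexOf φ₁ u hu)) else []
  have hplace : ∀ u (hu : u ∈ optionSupport φ₁), place u = rep₂ (f (Γ₁.vertexOf φ₁ u hu)) :=
    fun u hu => dif_pos hu
  let idx : List S₁ → ShortWord S₁ ⌊lam * C⌋₊ := fun u =>
    if hu : u ∈ optionSupport φ₁ then index (Γ₁.vertexOf φ₁ u hu) else ⟨[], by simp⟩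
  have hidx : ∀ u (hu : u ∈ optionSupport φ₁), idx u = index (Γ₁.vertexOf φ₁ u hu) :=
    fun u hu => dif_pos hu
  -- Index length from the fibre bound, pointer length from the upper bound on an edge (distance at
  -- most 1), search radius from coarse surjectivity.
  refine ⟨⌊lam * C⌋₊, ⌊lam * 1 + C⌋₊, ⌊D⌋₊, ⟨⟨place, idx, ?_, ?_, ?_, ?_, ?_⟩⟩⟩
  · intro u v huv
    rw [hplace u huv.1, hplace v huv.2.1, hidx u huv.1, hidx v huv.2.1,
      (vertexOf_eq_iff (hu := huv.1) (hv := huv.2.1)).2 huv]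
    exact ⟨rfl, rfl⟩
  · intro u hu
    rw [hplace u hu]
    exact hrep₂ _
  · intro u hu v hv huv he
    rw [hplace u hu, hplace v hv] at huv
    rw [hidx u hu, hidx v hv] at he
    have hfe : f (Γ₁.vertexOf φ₁ u hu) = f (Γ₁.vertexOf φ₁ v hv) := by
      rw [hrep₂' (f (Γ₁.vertexOf φ₁ u hu)), hrep₂' (f (Γ₁.vertexOf φ₁ v hv))]
      exact vertexOf_eq_iff.2 huv
    have h3 := hindex' (Γ₁.vertexOf φ₁ u hu)
    have h4 := hindex' (Γ₁.vertexOf φ₁ v hv)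
    rw [vertexOf_eq_iff] at h3 h4
    rw [hfe, he] at h3
    exact h3.trans h4.symm
  · intro u s hs
    have hu : u ∈ optionSupport φ₁ := by
      intro h
      rw [h] at hs
      cases hs
    have hus := h₁.1.apply_append_singleton_ne_none.2 hs
    have h := (hqi (Γ₁.vertexOf φ₁ u hu) (Γ₁.vertexOf φ₁ (u ++ [s]) hus)).2.trans
      (add_le_add_left (mul_le_mul_of_nonneg_left (directedDist_le_one (edge_append hs hu hus))
        hlam0.le) C)
    rw [hrep₂' (f (Γ₁.vertexOf φ₁ u hu))] at h
    obtain ⟨z, hz, hmem, hz'⟩ := exists_word_of_dist_le hc₂ hs₂ h₂ _ h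
    refine ⟨z, Nat.le_floor hz, ?_⟩
    rw [hplace u hu, hplace _ hus]
    rw [hrep₂' (f (Γ₁.vertexOf φ₁ (u ++ [s]) hus)), vertexOf_eq_iff] at hz'
    exact hz'.symm
  · intro w hw
    obtain ⟨x, hx⟩ := hdense (Γ₂.vertexOf φ₂ w hw)
    obtain ⟨z, hz, hmem, hz'⟩ :=
      exists_word_of_dist_le hc₂ hs₂ h₂ hw ((le_max_left _ _).trans hx)
    refine ⟨z, Nat.le_floor hz, rep₁ x, hrep₁ x, ?_⟩
    rw [hplace _ (hrep₁ x), ← hrep₁' x]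
    rw [hrep₂' (f x), vertexOf_eq_iff] at hz'
    exact hz'.symm

/-! ### Moving configurations between models by minimality and compactness. -/

theorem shiftBy_mem_modelSubshift {M S A : Type*} {Γ : Blueprint M S} {φ : List S → Option M}
    (hc : Γ.Coherent) (h : φ ∈ Γ.modelSpace) {F : Set (BlueprintPattern M S A)}
    {x : List S → Option A} (hx : x ∈ Γ.modelSubshift φ F) {w : List S}
    (hw : w ∈ optionSupport φ) : shiftBy x w ∈ Γ.modelSubshift (shiftBy φ w) F := by
  obtain ⟨h1, h2, h3⟩ := hx
  refine ⟨?_, fun u hu v hv huv => ?_, fun p hp v hv => ?_⟩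
  · ext u
    exact Set.ext_iff.1 h1 (w ++ u)
  · obtain ⟨h4, h5, h6⟩ := SameVertex.prepend hc h hw ⟨hu, hv, huv⟩
    exact h2 _ h4 _ h5 h6
  · obtain ⟨u, hu, hne⟩ := h3 p hp (w ++ v) hv
    refine ⟨u, hu, ?_⟩
    simpa [shiftBy] using hne

/-- If the orbit of `φ` accumulates at a model `ψ`, then configurations on `φ` yield configurations
on `ψ`, by compactness. -/
theorem modelSubshift_nonempty_of_denseModel {M S A : Type*} [Finite M] [Finite A]
    {Γ : Blueprint M S} {φ ψ : List S → Option M} (hc : Γ.Coherent) (h : φ ∈ Γ.modelSpace)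
    (hψ : ψ ∈ Γ.modelSpace) (hd : Γ.DenseModel φ) {F : Set (BlueprintPattern M S A)}
    (hF : (Γ.modelSubshift φ F).Nonempty) : (Γ.modelSubshift ψ F).Nonempty := by
  obtain ⟨x, hx⟩ := hF
  let _ : TopologicalSpace (Option M) := ⊥
  have : DiscreteTopology (Option M) := ⟨rfl⟩
  let _ : TopologicalSpace (Option A) := ⊥
  have : DiscreteTopology (Option A) := ⟨rfl⟩
  let Z : Set ((List S → Option M) × (List S → Option A)) := {q | q.2 ∈ Γ.modelSubshift q.1 F}
  have hval : ∀ u v : List S, Continuous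
      fun q : (List S → Option M) × (List S → Option A) => ((q.1 u, q.1 v), (q.2 u, q.2 v)) :=
    fun u v => by fun_prop
  have hclopen : ∀ (u v : List S) (P : (Option M × Option M) × (Option A × Option A) → Prop),
      IsClosed {q : (List S → Option M) × (List S → Option A) |
        P ((q.1 u, q.1 v), (q.2 u, q.2 v))} := fun u v P =>
    (isClosed_discrete {z | P z}).preimage (hval u v)
  -- Each condition looks at finitely many coordinates; for the patterns this uses their finite
  -- supports.
  have hZ : IsClosed Z := by
    have hZe : Z = (⋂ u : List S, {q | q.2 u ≠ none ↔ q.1 u ≠ none}) ∩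
        ((⋂ u : List S, ⋂ v : List S, ⋂ _ : Γ.Equivalent u v,
          {q | q.1 u ≠ none → q.1 v ≠ none → q.2 u = q.2 v}) ∩
        ⋂ p ∈ F, ⋂ w : List S, ({q | q.1 w = none} ∪
          ⋃ u ∈ optionSupport p.toFun,
            {q | Option.map₂ Prod.mk (q.1 (w ++ u)) (q.2 (w ++ u)) ≠ p.toFun u})) := by
      ext q
      simp only [Z, modelSubshift, Set.mem_inter_iff, Set.mem_iInter, Set.mem_union,
        Set.mem_iUnion, Set.mem_ofPred_eq, exists_prop]
      refine and_congr Set.ext_iff (and_congr ?_ ?_)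
      · exact ⟨fun h u v huv hu hv => h u hu v hv huv, fun h u hu v hv huv => h u v huv hu hv⟩
      · refine forall₃_congr fun p hp w => ?_
        rw [or_iff_not_imp_left]
        exact Iff.rfl
    rw [hZe]
    refine (isClosed_iInter fun u => ?_).inter ((isClosed_iInter fun u => isClosed_iInter fun v =>
      isClosed_iInter fun _ => ?_).inter (isClosed_biInter fun p _ => isClosed_iInter fun w =>
        IsClosed.union ?_ (p.finite_support.isClosed_biUnion fun u _ => ?_)))
    · exact hclopen u u fun z => z.2.1 ≠ none ↔ z.1.1 ≠ none
    · exact hclopen u v fun z => z.1.1 ≠ none → z.1.2 ≠ none → z.2.1 = z.2.2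
    · exact hclopen w w fun z => z.1.1 = none
    · exact hclopen (w ++ u) (w ++ u) fun z => Option.map₂ Prod.mk z.1.1 z.2.1 ≠ p.toFun u
  -- Finiteness of the states and of the alphabet makes the product compact. The maps that carry a
  -- configuration thus form a closed set, which contains the orbit of `φ` and hence `ψ`.
  have himage : IsClosed (Prod.fst '' Z) := (hZ.isCompact.image continuous_fst).isClosed
  have horbit : orbit φ ⊆ Prod.fst '' Z := by
    rintro _ ⟨w, hw, rfl⟩
    exact ⟨(shiftBy φ w, shiftBy x w), shiftBy_mem_modelSubshift hc h hx hw, rfl⟩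
  have hmem : ψ ∈ closure (orbit φ) := by
    have : closure (orbit φ) = Γ.modelSpace := hd
    rwa [this]
  obtain ⟨q, hq, rfl⟩ := closure_minimal horbit himage hmem
  exact ⟨q.2, hq⟩

end Blueprint

/-! ### Choice of the window size and conclusion. -/

theorem exists_length_bound {S : Type*} {R : Set (List S × List S)} (h : R.Finite) (r d : ℕ) :
    ∃ L, r ≤ L ∧ d ≤ L ∧ ∀ ρ ∈ R, r * ρ.1.length ≤ L ∧ r * ρ.2.length ≤ L := by
  obtain ⟨b, hb⟩ := (h.image fun ρ => r * ρ.1.length + r * ρ.2.length).bddAbove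
  refine ⟨r + d + b, by omega, by omega, fun ρ hρ => ?_⟩
  have := hb ⟨ρ, hρ, rfl⟩
  dsimp only at this
  omega

theorem mainTheorem8 {M₁ S₁ M₂ S₂ : Type*}
    [Primcodable M₁] [Primcodable S₁] [Primcodable M₂] [Primcodable S₂]
    (Γ₁ : Blueprint M₁ S₁) (Γ₂ : Blueprint M₂ S₂)
    (hfp₁ : Γ₁.FinitelyPresented) (hfp₂ : Γ₂.FinitelyPresented)
    (hcoh₁ : Γ₁.Coherent) (hcoh₂ : Γ₂.Coherent)
    (hsc₁ : Γ₁.StronglyConnected) (hsc₂ : Γ₂.StronglyConnected)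
    (hmin : Γ₁.Minimal)
    (φ₂ : List S₂ → Option M₂) (hφ₂ : φ₂ ∈ Γ₂.modelSpace)
    (hqi : ∃ φ₁ ∈ Γ₁.modelSpace, ∃ f : Γ₁.vertices φ₁ → Γ₂.vertices φ₂,
      IsQuasiIsometry (Γ₁.modelDist φ₁) (Γ₂.modelDist φ₂) f) :
    ManyOneReducible Γ₁.DominoProblem (Γ₂.ModelDominoProblem φ₂) := by
  obtain ⟨φ₁, hφ₁, f, hf⟩ := hqi
  obtain ⟨_, _, hrels⟩ := hfp₁
  obtain ⟨_, _, -⟩ := hfp₂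
  obtain ⟨R, r, d, ⟨V⟩⟩ := Blueprint.exists_vertexCoding hcoh₁ hsc₁ hφ₁ hcoh₂ hsc₂ hφ₂ hf
  obtain ⟨L, hr, hd, hL⟩ := exists_length_bound hrels r d
  obtain ⟨g, hg, hgI⟩ := (Cell.rules Γ₁ Γ₂ (ShortWord S₁ R) r).exists_computable L hcoh₂ hsc₂ hφ₂
  refine ⟨g, hg, fun I => ?_⟩
  rw [hgI]
  constructor
  · rintro ⟨⟨φ, x⟩, hφ, hx⟩
    -- The given configuration lives on an arbitrary model `φ`; it is replaced by one on `φ₁`, the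
    -- model that can be drawn on `φ₂`.
    obtain ⟨y, hy⟩ := Blueprint.modelSubshift_nonempty_of_denseModel hcoh₁ hφ hφ₁ (hmin φ hφ) ⟨x, hx⟩
    exact ⟨_, _, V.realizes_cells hcoh₁ hφ₁ hcoh₂ hsc₂ hφ₂ hr hd hy⟩
  · rintro ⟨κ, c, h⟩
    exact Cell.dominoProblem_of_realizes hcoh₁ hcoh₂ hφ₂ h hr hL
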